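/- Let $d\ge 2$. A Borel probability measure $\sigma$ on $\mathbb{R}^d$ is called admissible if it is symmetric around $0$, its support $\operatorname{supp}\sigma$ is compact, $0\notin\operatorname{supp}\sigma$, and its Fourier transform $\hat\sigma(\xi)=\int e^{-2\pi i\langle x,\xi\rangle}\,d\sigma(x)$ tends to $0$ as $|\xi|\to\infty$. A set $A\subset\mathbb{R}^d$ is $\sigma$-avoiding if there are no $x,y\in A$ with $x-y\in\operatorname{supp}\sigma$. For measures $\sigma,\tau$, the set $A$ is ($\sigma$ OR $\tau$)-avoiding if for every $x\in A$ either there is no $y\in A$ with $x-y\in\operatorname{supp}\sigma$, or there is no $y\in A$ with $x-y\in\operatorname{supp}\tau$. For $t>0$ let $t\cdot\sigma$ be the image of $\sigma$ under $x\mapsto tx$. For a property $P$ of sets let $m(P)=\sup_A\bar d(A)$, where the supremum is over the Lebesgue measurable sets $A\subset\mathbb{R}^d$ with property $P$, and $\bar d(A)=\limsup_{R\to\infty}|A\cap Q(0,R)|/|Q(0,R)|$, with $Q(0,R)$ the open axis-parallel cube of side length $R$ centered at the origin. **Theorem.** Let $\sigma_1,\sigma_2$ be admissible measures on $\mathbb{R}^d$.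 Let $P_1$, $P_2$ and $P_1\text{ OR }t\cdot P_2$ denote the properties of being $\sigma_1$-avoiding, $\sigma_2$-avoiding and ($\sigma_1$ OR $t\cdot\sigma_2$)-avoiding, respectively. Then $$\lim_{t\to\infty} m(P_1\text{ OR }t\cdot P_2)=\max\bigl(m(P_1),m(P_2)\bigr).$$ -/

import Mathlib

open MeasureTheory Filter Topology

noncomputable section

/-- Euclidean space of dimension `d`. -/
abbrev Euc (d : ℕ) : Type := EuclideanSpace ℝ (Fin d)

/-- The open axis-parallel cube of side length `r` centred at `x`. -/
def cube {d : ℕ} (x : Euc d) (r : ℝ) : Set (Euc d) :=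
  {y | ∀ i, |y i - x i| < r / 2}

/-- The density `|A ∩ Ω| / |Ω|` of `A` on `Ω`. -/
def densityOn {d : ℕ} (Ω A : Set (Euc d)) : ℝ :=
  volume.real (A ∩ Ω) / volume.real Ω

/-- The upper density of `A`: the upper limit, as `R → ∞`, of the density of `A` on the cube of
side length `R` centred at the origin. -/
def upperDensity {d : ℕ} (A : Set (Euc d)) : ℝ :=
  limsup (fun R : ℝ => densityOn (cube 0 R) A) atTop

/-- The supremum of the upper densities of the Lebesgue measurable sets with the property `P`. -/
def maxDensity {d : ℕ} (P : Set (Euc d) → Prop) : ℝ :=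
  sSup {a : ℝ | ∃ A : Set (Euc d), NullMeasurableSet A volume ∧ P A ∧ a = upperDensity A}

/-- The Fourier transform `ξ ↦ ∫ exp (-2πi⟨x, ξ⟩) dσ(x)` of a measure. -/
def measureFourier {d : ℕ} (σ : Measure (Euc d)) (ξ : Euc d) : ℂ :=
  ∫ x, Complex.exp (-(2 * Real.pi * (inner ℝ x ξ : ℝ) : ℂ) * Complex.I) ∂σ

/-- Admissible measures: probability measures that are symmetric around the origin, have compact
support not containing the origin, and whose Fourier transform tends to `0` at infinity. -/
structure Admissible {d : ℕ} (σ : Measure (Euc d)) : Prop where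
  isProbabilityMeasure : IsProbabilityMeasure σ
  symmetric : ∀ B : Set (Euc d), MeasurableSet B → σ ((fun x => -x) ⁻¹' B) = σ B
  compact_support : IsCompact σ.support
  zero_notMem_support : (0 : Euc d) ∉ σ.support
  fourier_tendsto_zero : Tendsto (measureFourier σ) (comap norm atTop) (𝓝 0)

/-- `A` is `σ`-avoiding: no two points of `A` differ by an element of the support of `σ`. -/
def Avoiding {d : ℕ} (σ : Measure (Euc d)) (A : Set (Euc d)) : Prop :=
  ¬ ∃ x ∈ A, ∃ y ∈ A, x - y ∈ σ.support

/-- `A` is `σ₁ OR σ₂`-avoiding: for every `x ∈ A`, either no `y ∈ A` has `x - y ∈ supp σ₁`, or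
no `y ∈ A` has `x - y ∈ supp σ₂`. -/
def OrAvoiding {d : ℕ} (σ₁ σ₂ : Measure (Euc d)) (A : Set (Euc d)) : Prop :=
  ∀ x ∈ A, (¬ ∃ y ∈ A, x - y ∈ σ₁.support) ∨ (¬ ∃ y ∈ A, x - y ∈ σ₂.support)

/-- The dilate `t · σ`: the image of `σ` under `x ↦ t x`. -/
def dilate {d : ℕ} (t : ℝ) (σ : Measure (Euc d)) : Measure (Euc d) :=
  σ.map (fun x => t • x)

end

open scoped Pointwise ENNReal FourierTransform ComplexConjugate

variable {d : ℕ}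

/-! The lower bound is soft: a set avoiding one of the two supports is OR-avoiding, and
`avoidDensity` does not change under dilation.

For the upper bound, suppose the density stays above `M`, the maximum of m₁ = `avoidDensity
σ₁.support` and m₂ = `avoidDensity σ₂.support`, along some tₙ → ∞. Shrinking by tₙ and cutting out a
good window gives compact sets Aₙ in one fixed cube of side L, of volume at least aLᵈ with a > M,
that avoid sₙσ₁ OR σ₂ with sₙ = 1/tₙ → 0. Let Bₙ be the points of Aₙ without σ₂-neighbour in Aₙ;
then Aₙ \ Bₙ avoids sₙσ₁. Pass to weak limits g ≤ f of the indicators of Bₙ and Aₙ, and put S = {g >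
0}, T = {f > 0}.

The pair count ∫ g · (σ₂ ∗ f) is weakly continuous because the Fourier transform of σ₂ decays
(`tendsto_integral_conj_mul_smear`). It is zero for every n, hence in the limit, and Lebesgue
density points upgrade this to: up to null sets, no point of S has a σ₂-neighbour in T
(`exists_subsets_no_pairs`). So S can be completed by a translate of a nearly optimal σ₂-avoiding
set inside T \ S, which gives |S| + m₂|T \ S| ≤ m₂(L+ρ)ᵈ (`volume_add_le_avoidDensity`), where ρ
bounds the coordinates of the support of σ₂. On T \ S only Aₙ \ Bₙ matters, and its constraint lives
at the vanishing scale sₙ, so the mass of f there is at most m₁|T \ S|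
(`setIntegral_le_avoidDensity`). As f ≤ 1 on S, the two bounds yield ∫ f ≤ M(L+ρ)ᵈ, which is below
aLᵈ once L is large. -/

/-- No two points of `A` differ by an element of `K`. -/
def SetAvoiding (K A : Set (Euc d)) : Prop :=
  ∀ x ∈ A, ∀ y ∈ A, x - y ∉ K

/-- Every point of `A` has either no `K₁`-neighbour in `A` or no `K₂`-neighbour in `A`. -/
def SetOrAvoiding (K₁ K₂ A : Set (Euc d)) : Prop :=
  ∀ x ∈ A, (∀ y ∈ A, x - y ∉ K₁) ∨ (∀ y ∈ A, x - y ∉ K₂)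

/-- The largest upper density of a set avoiding the differences in `K`. -/
noncomputable def avoidDensity (K : Set (Euc d)) : ℝ :=
  maxDensity (SetAvoiding K)

theorem avoiding_iff_setAvoiding (σ : Measure (Euc d)) :
    Avoiding σ = SetAvoiding σ.support := by
  ext A
  simp only [Avoiding, SetAvoiding]
  push Not
  rfl

theorem orAvoiding_iff_setOrAvoiding (σ τ : Measure (Euc d)) :
    OrAvoiding σ τ = SetOrAvoiding σ.support τ.support := by
  ext A
  simp only [OrAvoiding, SetOrAvoiding]
  push Not
  rfl

theorem SetAvoiding.mono {K A B : Set (Euc d)} (h : SetAvoiding K A) (hBA : B ⊆ A) :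
    SetAvoiding K B :=
  fun x hx y hy => h x (hBA hx) y (hBA hy)

theorem SetOrAvoiding.mono {K₁ K₂ A B : Set (Euc d)} (h : SetOrAvoiding K₁ K₂ A) (hBA : B ⊆ A) :
    SetOrAvoiding K₁ K₂ B :=
  fun x hx => (h x (hBA hx)).imp (fun h y hy => h y (hBA hy)) (fun h y hy => h y (hBA hy))

theorem SetAvoiding.preimage_sub {K A : Set (Euc d)} (h : SetAvoiding K A) (z : Euc d) :
    SetAvoiding K ((fun x => x - z) ⁻¹' A) := by
  intro x hx y hy hxy
  exact h _ hx _ hy (by simpa using hxy)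

theorem SetOrAvoiding.preimage_sub {K₁ K₂ A : Set (Euc d)} (h : SetOrAvoiding K₁ K₂ A)
    (z : Euc d) : SetOrAvoiding K₁ K₂ ((fun x => x - z) ⁻¹' A) := by
  intro x hx
  refine (h _ hx).imp (fun h y hy hxy => h _ hy (by simpa using hxy))
    (fun h y hy hxy => h _ hy (by simpa using hxy))

/-! ### Cubes -/

theorem cube_eq_preimage (x : Euc d) (r : ℝ) :
    cube x r = (WithLp.ofLp : Euc d → Fin d → ℝ) ⁻¹'
      (Set.univ.pi fun i => Set.Ioo (x i - r / 2) (x i + r / 2)) := by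
  ext y
  simp only [cube, Set.mem_ofPred_eq, Set.mem_preimage, Set.mem_pi, Set.mem_univ, true_imp_iff,
    Set.mem_Ioo, abs_lt]
  refine forall_congr' fun i => ?_
  constructor <;> rintro ⟨h1, h2⟩ <;> constructor <;> linarith

theorem measurableSet_pi_Ioo (a b : Fin d → ℝ) :
    MeasurableSet (Set.univ.pi fun i => Set.Ioo (a i) (b i)) :=
  MeasurableSet.univ_pi fun _ => measurableSet_Ioo

theorem measurableSet_cube (x : Euc d) (r : ℝ) : MeasurableSet (cube x r) := by
  rw [cube_eq_preimage]
  exact (PiLp.volume_preserving_ofLp (Fin d)).measurable (measurableSet_pi_Ioo _ _)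

theorem volume_cube (x : Euc d) (r : ℝ) : volume (cube x r) = ENNReal.ofReal r ^ d := by
  rw [cube_eq_preimage, (PiLp.volume_preserving_ofLp (Fin d)).measure_preimage
    (measurableSet_pi_Ioo _ _).nullMeasurableSet, Real.volume_pi_Ioo]
  simp [add_sub_sub_cancel, add_halves]

theorem volume_cube_lt_top (x : Euc d) (r : ℝ) : volume (cube x r) < ∞ := by
  rw [volume_cube]
  exact ENNReal.pow_lt_top ENNReal.ofReal_lt_top

theorem volume_real_cube (x : Euc d) {r : ℝ} (hr : 0 ≤ r) : volume.real (cube x r) = r ^ d := by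
  rw [Measure.real, volume_cube, ENNReal.toReal_pow, ENNReal.toReal_ofReal hr]

theorem smul_cube {s : ℝ} (hs : 0 < s) (r : ℝ) : s • cube (0 : Euc d) r = cube 0 (s * r) := by
  ext y
  rw [Set.mem_smul_set_iff_inv_smul_mem₀ hs.ne']
  simp only [cube, Set.mem_ofPred_eq, PiLp.smul_apply, PiLp.zero_apply, sub_zero, smul_eq_mul,
    abs_mul, abs_inv, abs_of_pos hs]
  refine forall_congr' fun i => ?_
  rw [inv_mul_lt_iff₀ hs, mul_div_assoc]

theorem norm_le_of_mem_cube {r : ℝ} (hr : 0 ≤ r) {y : Euc d} (hy : y ∈ cube 0 r) :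
    ‖y‖ ≤ d * r := by
  have h1 : ‖y‖ ≤ ∑ i, ‖y i‖ := by
    conv_lhs => rw [← (EuclideanSpace.basisFun (Fin d) ℝ).sum_repr y]
    refine (norm_sum_le _ _).trans (le_of_eq ?_)
    simp [norm_smul]
  refine h1.trans ?_
  have : ∀ i, ‖y i‖ ≤ r := fun i => by
    have := hy i
    simp only [PiLp.zero_apply, sub_zero] at this
    rw [Real.norm_eq_abs]; linarith
  calc ∑ i, ‖y i‖ ≤ ∑ i : Fin d, r := Finset.sum_le_sum fun i _ => this i
    _ = d * r := by simp

/-! ### Upper density -/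

theorem densityOn_nonneg (Ω A : Set (Euc d)) : 0 ≤ densityOn Ω A := by
  unfold densityOn; positivity

theorem densityOn_cube_le_one (x : Euc d) (r : ℝ) (A : Set (Euc d)) :
    densityOn (cube x r) A ≤ 1 :=
  div_le_one_of_le₀ (measureReal_mono Set.inter_subset_right (volume_cube_lt_top x r).ne)
    measureReal_nonneg

theorem isBoundedUnder_density (A : Set (Euc d)) :
    IsBoundedUnder (· ≤ ·) atTop (fun R : ℝ => densityOn (cube 0 R) A) :=
  isBoundedUnder_of ⟨1, fun _ => densityOn_cube_le_one _ _ _⟩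

theorem isCoboundedUnder_density (A : Set (Euc d)) :
    IsCoboundedUnder (· ≤ ·) atTop (fun R : ℝ => densityOn (cube 0 R) A) :=
  (isBoundedUnder_of ⟨0, fun _ => densityOn_nonneg _ _⟩ :
    IsBoundedUnder (· ≥ ·) atTop _).isCoboundedUnder_le

theorem upperDensity_nonneg (A : Set (Euc d)) : 0 ≤ upperDensity A :=
  le_limsup_of_frequently_le (Frequently.of_forall fun _ => densityOn_nonneg _ _)
    (isBoundedUnder_density A)

theorem upperDensity_le_one (A : Set (Euc d)) : upperDensity A ≤ 1 :=
  limsup_le_of_le (isCoboundedUnder_density A)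
    (Eventually.of_forall fun _ => densityOn_cube_le_one _ _ _)

theorem upperDensity_congr_ae {A B : Set (Euc d)} (h : A =ᵐ[volume] B) :
    upperDensity A = upperDensity B := by
  unfold upperDensity densityOn
  congr 1
  ext R
  exact congrArg (· / _) (measureReal_congr (h.inter (ae_eq_refl _)))

theorem le_maxDensity {P : Set (Euc d) → Prop} {A : Set (Euc d)}
    (hA : NullMeasurableSet A volume) (hP : P A) : upperDensity A ≤ maxDensity P := by
  refine le_csSup ⟨1, ?_⟩ ⟨A, hA, hP, rfl⟩
  rintro _ ⟨B, -, -, rfl⟩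
  exact upperDensity_le_one B

theorem maxDensity_nonneg (P : Set (Euc d) → Prop) : 0 ≤ maxDensity P := by
  refine Real.sSup_nonneg ?_
  rintro _ ⟨B, -, -, rfl⟩
  exact upperDensity_nonneg B

/-- A hereditary property survives the passage to a measurable subset of full measure, so
null-measurable competitors can be traded for measurable ones. -/
theorem exists_measurable_lt_upperDensity {P : Set (Euc d) → Prop} (h0 : P ∅)
    (hmono : ∀ A B, P A → B ⊆ A → P B) {a : ℝ} (ha : a < maxDensity P) :
    ∃ A : Set (Euc d), MeasurableSet A ∧ P A ∧ a < upperDensity A := by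
  obtain ⟨_, ⟨A, hA, hPA, rfl⟩, h⟩ := exists_lt_of_lt_csSup
    (by exact ⟨_, ∅, MeasurableSet.empty.nullMeasurableSet, h0, rfl⟩) ha
  obtain ⟨B, hBA, hB, hae⟩ := hA.exists_measurable_subset_ae_eq
  exact ⟨B, hB, hmono A B hPA hBA, by rwa [upperDensity_congr_ae hae]⟩

theorem maxDensity_mono {P Q : Set (Euc d) → Prop} (h0 : P ∅) (h : ∀ A, P A → Q A) :
    maxDensity P ≤ maxDensity Q := by
  refine csSup_le ⟨_, ∅, MeasurableSet.empty.nullMeasurableSet, h0, rfl⟩ ?_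
  rintro _ ⟨A, hA, hPA, rfl⟩
  exact le_maxDensity hA (h A hPA)

/-! ### Behaviour under dilations -/

theorem densityOn_smul {s : ℝ} (hs : 0 < s) (A : Set (Euc d)) (R : ℝ) :
    densityOn (cube 0 (s * R)) (s • A) = densityOn (cube 0 R) A := by
  unfold densityOn
  rw [← smul_cube hs, ← Set.smul_set_inter₀ hs.ne']
  simp only [Measure.real, Measure.addHaar_smul, ENNReal.toReal_mul]
  rw [ENNReal.toReal_ofReal (abs_nonneg _)]
  refine mul_div_mul_left _ _ ?_
  positivity

theorem upperDensity_smul {s : ℝ} (hs : 0 < s) (A : Set (Euc d)) :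
    upperDensity (s • A) = upperDensity A := by
  unfold upperDensity
  have h : map (fun R : ℝ => s * R) atTop = atTop := (OrderIso.mulLeft₀ s hs).map_atTop
  conv_lhs => rw [← h]
  rw [← limsup_comp]
  congr 1
  ext R
  exact densityOn_smul hs A R

theorem SetAvoiding.smul {s : ℝ} (hs : s ≠ 0) {K A : Set (Euc d)} (h : SetAvoiding K A) :
    SetAvoiding (s • K) (s • A) := by
  rintro _ ⟨x, hx, rfl⟩ _ ⟨y, hy, rfl⟩ ⟨k, hk, hxy⟩
  simp only [← smul_sub] at hxy
  exact h x hx y hy (smul_right_injective _ hs hxy ▸ hk)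

theorem SetOrAvoiding.smul {s : ℝ} (hs : s ≠ 0) {K₁ K₂ A : Set (Euc d)}
    (h : SetOrAvoiding K₁ K₂ A) : SetOrAvoiding (s • K₁) (s • K₂) (s • A) := by
  rintro _ ⟨x, hx, rfl⟩
  refine (h x hx).imp ?_ ?_ <;>
  · rintro h _ ⟨y, hy, rfl⟩ ⟨k, hk, hxy⟩
    simp only [← smul_sub] at hxy
    exact h y hy (smul_right_injective _ hs hxy ▸ hk)

theorem avoidDensity_le_smul {s : ℝ} (hs : 0 < s) (K : Set (Euc d)) :
    avoidDensity K ≤ avoidDensity (s • K) := by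
  refine csSup_le ⟨_, ∅, MeasurableSet.empty.nullMeasurableSet, fun x hx => hx.elim, rfl⟩ ?_
  rintro _ ⟨A, hA, hPA, rfl⟩
  rw [← upperDensity_smul hs]
  have hsA : NullMeasurableSet (s • A) volume := by
    rw [← Set.preimage_smul_inv₀ hs.ne']
    exact hA.preimage (Measure.quasiMeasurePreserving_smul _ (inv_ne_zero hs.ne'))
  exact le_maxDensity hsA (hPA.smul hs.ne')

theorem avoidDensity_smul {s : ℝ} (hs : 0 < s) (K : Set (Euc d)) :
    avoidDensity (s • K) = avoidDensity K := by
  refine le_antisymm ?_ (avoidDensity_le_smul hs K)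
  have := avoidDensity_le_smul (inv_pos.2 hs) (s • K)
  rwa [inv_smul_smul₀ hs.ne'] at this

theorem support_dilate {t : ℝ} (ht : t ≠ 0) (σ : Measure (Euc d)) :
    (dilate t σ).support = t • σ.support := by
  ext x
  have hm : Measurable (fun x : Euc d => t • x) := measurable_const_smul t
  let e : Euc d ≃ₜ Euc d := Homeomorph.smulOfNeZero t ht
  rw [Set.mem_smul_set_iff_inv_smul_mem₀ ht, Measure.mem_support_iff_forall,
    Measure.mem_support_iff_forall]
  have he : MeasurableEmbedding (fun x : Euc d => t • x) := e.measurableEmbedding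
  constructor
  · intro h U hU
    have h1 : t • U ∈ 𝓝 x := by
      have := (smul_mem_nhds_smul_iff₀ (x := t⁻¹ • x) (s := U) ht).2 hU
      rwa [smul_inv_smul₀ ht] at this
    have := h _ h1
    rwa [dilate, he.map_apply, Set.preimage_smul₀ ht, inv_smul_smul₀ ht] at this
  · intro h U hU
    rw [dilate, he.map_apply, Set.preimage_smul₀ ht]
    exact h _ ((smul_mem_nhds_smul_iff₀ (inv_ne_zero ht)).2 hU)

theorem volume_preimage_sub_const (z : Euc d) (S : Set (Euc d)) :
    volume ((fun x => x - z) ⁻¹' S) = volume S := by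
  simp only [sub_eq_add_neg]
  exact measure_preimage_add_right _ _ _

/-! ### Averaging over translates -/

/-- Tonelli for the set of pairs (z, y) with y ∈ S and y - z ∈ T. -/
theorem lintegral_volume_inter_translate {S T : Set (Euc d)} (hS : MeasurableSet S)
    (hT : MeasurableSet T) :
    ∫⁻ z, volume (S ∩ (fun x => x - z) ⁻¹' T) = volume S * volume T := by
  have hm : MeasurableSet {p : Euc d × Euc d | p.2 ∈ S ∧ p.2 - p.1 ∈ T} :=
    (measurable_snd hS).inter ((measurable_snd.sub measurable_fst) hT)
  have h1 := Measure.prod_apply (μ := (volume : Measure (Euc d))) (ν := (volume : Measure (Euc d))) hm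
  have h2 := Measure.prod_apply_symm (μ := (volume : Measure (Euc d)))
    (ν := (volume : Measure (Euc d))) hm
  have h3 : ∀ y : Euc d, volume ((fun x => (x, y)) ⁻¹' {p : Euc d × Euc d | p.2 ∈ S ∧ p.2 - p.1 ∈ T})
      = S.indicator (fun _ => volume T) y := by
    intro y
    by_cases hy : y ∈ S
    · rw [Set.indicator_of_mem hy, ← (Measure.measurePreserving_sub_left (volume : Measure (Euc d))
        y).measure_preimage hT.nullMeasurableSet]
      congr 1
      ext x
      simp [hy]
    · rw [Set.indicator_of_notMem hy]
      simp [hy]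
  calc ∫⁻ z, volume (S ∩ (fun x => x - z) ⁻¹' T)
      = ∫⁻ y, S.indicator (fun _ => volume T) y := by
        rw [← lintegral_congr h3, ← h2, h1]; rfl
    _ = _ := by rw [lintegral_indicator hS, setLIntegral_const, mul_comm]

/-- Pigeonhole: the intersection is empty unless z lies in the cube of side L + R, so some z does at
least as well as the mean over that cube. -/
theorem exists_translate_inter {L R : ℝ} {S T : Set (Euc d)}
    (hS : MeasurableSet S) (hT : MeasurableSet T) (hSL : S ⊆ cube 0 L) (hTR : T ⊆ cube 0 R)
    (hLR : 0 < L + R) :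
    ∃ z : Euc d, volume.real S * volume.real T ≤
      volume.real (S ∩ (fun x => x - z) ⁻¹' T) * (L + R) ^ d := by
  by_contra! hcon
  have hSf : volume S ≠ ∞ := ((measure_mono hSL).trans_lt (volume_cube_lt_top _ _)).ne
  have hTf : volume T ≠ ∞ := ((measure_mono hTR).trans_lt (volume_cube_lt_top _ _)).ne
  set c : ℝ≥0∞ := volume S * volume T / ENNReal.ofReal (L + R) ^ d with hc
  have hpos : ENNReal.ofReal (L + R) ^ d ≠ 0 := by positivity
  have hfin : ENNReal.ofReal (L + R) ^ d ≠ ∞ := (ENNReal.pow_lt_top ENNReal.ofReal_lt_top).ne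
  have hlt : ∀ z : Euc d, volume (S ∩ (fun x => x - z) ⁻¹' T) < c := by
    intro z
    have hzf : volume (S ∩ (fun x => x - z) ⁻¹' T) ≠ ∞ :=
      ((measure_mono Set.inter_subset_left).trans_lt hSf.lt_top).ne
    rw [hc, ENNReal.lt_div_iff_mul_lt (Or.inl hpos) (Or.inl hfin)]
    rw [← ENNReal.toReal_lt_toReal (ENNReal.mul_ne_top hzf hfin) (ENNReal.mul_ne_top hSf hTf),
      ENNReal.toReal_mul, ENNReal.toReal_mul, ENNReal.toReal_pow, ENNReal.toReal_ofReal hLR.le]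
    exact hcon z
  have hsupp : ∀ z : Euc d, z ∉ cube (0 : Euc d) (L + R) →
      volume (S ∩ (fun x => x - z) ⁻¹' T) = 0 := by
    intro z hz
    rw [← nonpos_iff_eq_zero, ← measure_empty (μ := (volume : Measure (Euc d)))]
    refine measure_mono ?_
    rintro x ⟨hx, hx'⟩
    refine hz fun i => ?_
    have h1 := hSL hx i
    have h2 := hTR hx' i
    simp only [PiLp.zero_apply, sub_zero, PiLp.sub_apply] at h1 h2 ⊢
    rw [abs_lt] at *
    constructor <;> linarith
  have key := lintegral_volume_inter_translate hS hT
  have h1 : ∫⁻ z, volume (S ∩ (fun x => x - z) ⁻¹' T)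
      = ∫⁻ z in cube (0 : Euc d) (L + R), volume (S ∩ (fun x => x - z) ⁻¹' T) := by
    rw [← lintegral_indicator (measurableSet_cube _ _)]
    refine lintegral_congr fun z => ?_
    by_cases hz : z ∈ cube (0 : Euc d) (L + R)
    · rw [Set.indicator_of_mem hz]
    · rw [Set.indicator_of_notMem hz, hsupp z hz]
  have hcube0 : volume (cube (0 : Euc d) (L + R)) ≠ 0 := by rw [volume_cube]; exact hpos
  have h2 : ∫⁻ z in cube (0 : Euc d) (L + R), volume (S ∩ (fun x => x - z) ⁻¹' T)
      < ∫⁻ z in cube (0 : Euc d) (L + R), c := by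
    refine setLIntegral_strict_mono (measurableSet_cube _ _) hcube0 measurable_const ?_ ?_
    · rw [← h1, key]; exact ENNReal.mul_ne_top hSf hTf
    · exact Eventually.of_forall fun z _ => hlt z
  rw [← h1, key, setLIntegral_const, volume_cube, hc, ENNReal.div_mul_cancel hpos hfin] at h2
  exact lt_irrefl _ h2

theorem tendsto_div_add_pow (L : ℝ) (d : ℕ) :
    Tendsto (fun R : ℝ => (R / (L + R)) ^ d) atTop (𝓝 1) := by
  have h : Tendsto (fun R : ℝ => R / (L + R)) atTop (𝓝 1) := by
    have h1 : Tendsto (fun R : ℝ => 1 - L / (L + R)) atTop (𝓝 (1 - 0)) :=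
      tendsto_const_nhds.sub (tendsto_const_nhds.div_atTop (tendsto_atTop_add_const_left _ _ tendsto_id))
    rw [sub_zero] at h1
    refine h1.congr' ?_
    filter_upwards [eventually_gt_atTop (-L)] with R hR
    have : L + R ≠ 0 := by linarith
    field_simp
    ring
  simpa using h.pow d

/-- Averaging over a huge cube of side R loses a factor (R/(L+R))ᵈ; it tends to 1, so the gap
between `a` and an intermediate density `b` absorbs it. -/
theorem exists_translate_of_lt_upperDensity {D S : Set (Euc d)} {a L : ℝ} (hL : 0 < L)
    (hD : MeasurableSet D) (hS : MeasurableSet S) (hSL : S ⊆ cube 0 L)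
    (ha : a < upperDensity D) :
    ∃ z : Euc d, a * volume.real S ≤ volume.real (S ∩ (fun x => x - z) ⁻¹' D) := by
  rcases lt_or_ge a 0 with ha0 | ha0
  · exact ⟨0, (mul_nonpos_of_nonpos_of_nonneg ha0.le measureReal_nonneg).trans measureReal_nonneg⟩
  have hSf : volume S ≠ ∞ := ((measure_mono hSL).trans_lt (volume_cube_lt_top _ _)).ne
  obtain ⟨b, hab, hb⟩ := exists_between ha
  have hb0 : 0 < b := ha0.trans_lt hab
  have hfreq : ∃ᶠ R : ℝ in atTop, b < densityOn (cube 0 R) D :=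
    frequently_lt_of_lt_limsup (isCoboundedUnder_density D) hb
  have hev : ∀ᶠ R : ℝ in atTop, a / b < (R / (L + R)) ^ d :=
    (tendsto_div_add_pow L d).eventually_const_lt ((div_lt_one hb0).2 hab)
  obtain ⟨R, hRb, hR, hR0⟩ := (hfreq.and_eventually (hev.and (eventually_gt_atTop 0))).exists
  obtain ⟨z, hz⟩ := exists_translate_inter hS (hD.inter (measurableSet_cube 0 R))
    hSL Set.inter_subset_right (by positivity)
  refine ⟨z, ?_⟩
  rw [densityOn, volume_real_cube _ hR0.le, lt_div_iff₀ (by positivity)] at hRb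
  rw [div_pow, div_lt_div_iff₀ hb0 (by positivity)] at hR
  have h1 : volume.real (S ∩ (fun x => x - z) ⁻¹' (D ∩ cube 0 R)) ≤
      volume.real (S ∩ (fun x => x - z) ⁻¹' D) :=
    measureReal_mono (by gcongr; exact Set.inter_subset_left)
      ((measure_mono Set.inter_subset_left).trans_lt hSf.lt_top).ne
  have hp : 0 < (L + R) ^ d := by positivity
  have hS0 : 0 ≤ volume.real S := measureReal_nonneg
  refine le_of_mul_le_mul_right ?_ hp
  calc a * volume.real S * (L + R) ^ d = volume.real S * (a * (L + R) ^ d) := by ring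
    _ ≤ volume.real S * (R ^ d * b) := by gcongr
    _ ≤ volume.real S * volume.real (D ∩ cube 0 R) := by gcongr; linarith
    _ ≤ _ := hz
    _ ≤ _ := by gcongr

/-! ### Periodization -/

/-- The point of `p ℤ^d` with integer coordinates `k`. -/
noncomputable def latticePoint (p : ℝ) (k : Fin d → ℤ) : Euc d :=
  WithLp.toLp 2 fun i => p * k i

@[simp] theorem latticePoint_apply (p : ℝ) (k : Fin d → ℤ) (i : Fin d) :
    latticePoint p k i = p * k i := rfl

theorem eq_of_lattice_translates_close {L ρ : ℝ} {x y : Euc d} {k l : Fin d → ℤ}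
    (hx : x - latticePoint (L + ρ) k ∈ cube 0 L) (hy : y - latticePoint (L + ρ) l ∈ cube 0 L)
    (h : ∀ i, |(x - y) i| < ρ) (hL : 0 < L) (hρ : 0 < ρ) : k = l := by
  ext i
  have h1 := hx i
  have h2 := hy i
  have h3 := h i
  simp only [PiLp.zero_apply, sub_zero, PiLp.sub_apply, latticePoint_apply, abs_lt] at h1 h2 h3
  have hp : 0 < L + ρ := by positivity
  have h4 : (L + ρ) * ((k i : ℝ) - l i) < (L + ρ) * 1 := by linarith
  have h5 : (L + ρ) * ((l i : ℝ) - k i) < (L + ρ) * 1 := by linarith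
  have h6 := lt_of_mul_lt_mul_left h4 hp.le
  have h7 := lt_of_mul_lt_mul_left h5 hp.le
  have h8 : k i - l i < 1 := by exact_mod_cast h6
  have h9 : l i - k i < 1 := by exact_mod_cast h7
  omega

/-- Repeating S along (L+ρ)ℤᵈ leaves corridors of width ρ between the copies, too wide for a
difference in K. The periodic set therefore still avoids K, and its density is at least |S|/(L+ρ)ᵈ.
-/
theorem volume_le_avoidDensity_of_subset_cube {K S : Set (Euc d)} {L ρ : ℝ} (hL : 0 < L)
    (hρ : 0 < ρ) (hK : ∀ v ∈ K, ∀ i, |v i| < ρ) (hS : MeasurableSet S) (hSL : S ⊆ cube 0 L)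
    (hav : SetAvoiding K S) : volume.real S ≤ avoidDensity K * (L + ρ) ^ d := by
  set p := L + ρ with hp
  have hp0 : 0 < p := by positivity
  let T : (Fin d → ℤ) → Set (Euc d) := fun k => (fun x => x - latticePoint p k) ⁻¹' S
  have hT : ∀ k, MeasurableSet (T k) := fun k => (measurable_sub_const _) hS
  have hSf : volume S ≠ ∞ := ((measure_mono hSL).trans_lt (volume_cube_lt_top _ _)).ne
  have hTv : ∀ k, volume.real (T k) = volume.real S := fun k => by
    simp only [T, Measure.real, volume_preimage_sub_const]
  have hU : MeasurableSet (⋃ k, T k) := MeasurableSet.iUnion hT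
  have hUav : SetAvoiding K (⋃ k, T k) := by
    intro x hx y hy hxy
    obtain ⟨k, hk⟩ := Set.mem_iUnion.1 hx
    obtain ⟨l, hl⟩ := Set.mem_iUnion.1 hy
    obtain rfl := eq_of_lattice_translates_close (hSL hk) (hSL hl) (hK _ hxy) hL hρ
    exact hav _ hk _ hl (by simpa using hxy)
  have hdisj : Pairwise (Function.onFun Disjoint T) := by
    intro k l hkl
    refine Set.disjoint_left.2 fun x hx hx' => hkl ?_
    exact eq_of_lattice_translates_close (hSL hx) (hSL hx') (by simp [hρ]) hL hρ
  rw [← div_le_iff₀ (by positivity)]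
  refine le_trans ?_ (le_maxDensity hU.nullMeasurableSet hUav)
  refine le_limsup_of_frequently_le ?_ (isBoundedUnder_density _)
  have htend : Tendsto (fun N : ℕ => (2 * (N : ℝ) + 1) * p) atTop atTop :=
    ((tendsto_natCast_atTop_atTop.const_mul_atTop two_pos).atTop_add
      tendsto_const_nhds).atTop_mul_const hp0
  -- An upper limit only needs a cofinal set of radii; at side (2N+1)p the cube holds whole cells,
  -- those with indices in [-N, N].
  refine htend.frequently (Frequently.of_forall fun N => ?_)
  have hR0 : (0 : ℝ) ≤ (2 * (N : ℝ) + 1) * p := by positivity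
  rw [densityOn, volume_real_cube _ hR0, mul_pow]
  let F : Finset (Fin d → ℤ) := Fintype.piFinset fun _ => Finset.Icc (-(N : ℤ)) N
  have hF : (F.card : ℝ) = (2 * (N : ℝ) + 1) ^ d := by
    simp only [F, Fintype.card_piFinset, Int.card_Icc, Finset.prod_const, Finset.card_univ,
      Fintype.card_fin]
    have : ((N : ℤ) + 1 - -(N : ℤ)).toNat = 2 * N + 1 := by omega
    rw [this]
    push_cast
    rfl
  have hsub : (⋃ k ∈ F, T k) ⊆ (⋃ k, T k) ∩ cube 0 ((2 * (N : ℝ) + 1) * p) := by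
    intro x hx
    obtain ⟨k, hkF, hk⟩ := Set.mem_iUnion₂.1 hx
    refine ⟨Set.mem_iUnion.2 ⟨k, hk⟩, fun i => ?_⟩
    have h1 := hSL hk i
    have h2 := Fintype.mem_piFinset.1 hkF i
    rw [Finset.mem_Icc] at h2
    have h3 : (-(N : ℝ)) ≤ k i := by exact_mod_cast h2.1
    have h4 : (k i : ℝ) ≤ N := by exact_mod_cast h2.2
    simp only [PiLp.zero_apply, sub_zero, PiLp.sub_apply, latticePoint_apply, abs_lt] at h1 ⊢
    have h5 := mul_le_mul_of_nonneg_left h3 hp0.le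
    have h6 := mul_le_mul_of_nonneg_left h4 hp0.le
    constructor <;> nlinarith
  have hvol : F.card * volume.real S ≤
      volume.real ((⋃ k, T k) ∩ cube 0 ((2 * (N : ℝ) + 1) * p)) := by
    refine le_trans (le_of_eq ?_) (measureReal_mono hsub
      ((measure_mono Set.inter_subset_right).trans_lt (volume_cube_lt_top _ _)).ne)
    rw [measureReal_biUnion_finset (fun k _ l _ hkl => hdisj hkl) (fun k _ => hT k)
      (fun k _ => by simpa [T, volume_preimage_sub_const] using hSf)]
    simp [hTv]
  rw [hF] at hvol
  rw [div_le_div_iff₀ (by positivity) (by positivity)]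
  calc volume.real S * ((2 * (N : ℝ) + 1) ^ d * p ^ d)
      = (2 * (N : ℝ) + 1) ^ d * volume.real S * p ^ d := by ring
    _ ≤ _ := by gcongr

/-- A local form of the density bound: slide a window of side ℓ over E. Each window obeys the
periodization bound, and a window meeting E is centred in the δ-thickening. Integrating over the
centres counts each point of A ∩ E with weight ℓᵈ. -/
theorem volume_inter_le_avoidDensity {K A E : Set (Euc d)} {ℓ ρ δ : ℝ} (hℓ : 0 < ℓ)
    (hρ : 0 < ρ) (hK : ∀ v ∈ K, ∀ i, |v i| < ρ) (hA : MeasurableSet A) (hE : MeasurableSet E)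
    (hEb : Bornology.IsBounded E) (hav : SetAvoiding K A) (hδ : d * ℓ < δ) :
    volume.real (A ∩ E) * ℓ ^ d ≤
      avoidDensity K * (ℓ + ρ) ^ d * volume.real (Metric.thickening δ E) := by
  set c := avoidDensity K * (ℓ + ρ) ^ d with hc
  have hc0 : 0 ≤ c := mul_nonneg (maxDensity_nonneg _) (by positivity)
  have hle : ∀ z : Euc d, volume ((A ∩ E) ∩ (fun x => x - z) ⁻¹' cube 0 ℓ) ≤
      (Metric.thickening δ E).indicator (fun _ => ENNReal.ofReal c) z := by
    intro z
    by_cases hz : z ∈ Metric.thickening δ E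
    · rw [Set.indicator_of_mem hz]
      have h1 : volume ((A ∩ E) ∩ (fun x => x - z) ⁻¹' cube 0 ℓ) =
          volume ((fun x => x - -z) ⁻¹' (A ∩ E) ∩ cube 0 ℓ) := by
        rw [← volume_preimage_sub_const (-z) ((A ∩ E) ∩ (fun x => x - z) ⁻¹' cube 0 ℓ)]
        congr 1
        ext x
        simp
      have h2 := volume_le_avoidDensity_of_subset_cube (K := K) hℓ hρ hK
        (S := (fun x => x - -z) ⁻¹' (A ∩ E) ∩ cube 0 ℓ)
        (((measurable_sub_const _) (hA.inter hE)).inter (measurableSet_cube _ _))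
        Set.inter_subset_right (((hav.mono Set.inter_subset_left).preimage_sub (-z)).mono
          Set.inter_subset_left)
      rw [h1]
      refine (ENNReal.le_ofReal_iff_toReal_le ?_ hc0).2 h2
      exact ((measure_mono Set.inter_subset_right).trans_lt (volume_cube_lt_top _ _)).ne
    · rw [Set.indicator_of_notMem hz, nonpos_iff_eq_zero,
        ← nonpos_iff_eq_zero, ← measure_empty (μ := (volume : Measure (Euc d)))]
      refine measure_mono ?_
      rintro x ⟨⟨-, hx⟩, hx'⟩
      refine hz (Metric.mem_thickening_iff.2 ⟨x, hx, ?_⟩)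
      rw [dist_comm, dist_eq_norm]
      exact (norm_le_of_mem_cube hℓ.le hx').trans_lt hδ
  have hfin : volume (Metric.thickening δ E) ≠ ∞ := hEb.thickening.measure_lt_top.ne
  have h1 := lintegral_mono (μ := (volume : Measure (Euc d))) hle
  rw [lintegral_volume_inter_translate (hA.inter hE) (measurableSet_cube _ _),
    lintegral_indicator Metric.isOpen_thickening.measurableSet, setLIntegral_const] at h1
  have h2 := ENNReal.toReal_mono (ENNReal.mul_ne_top ENNReal.ofReal_ne_top hfin) h1
  rw [ENNReal.toReal_mul, ENNReal.toReal_mul, ENNReal.toReal_ofReal hc0] at h2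
  rw [← volume_real_cube (0 : Euc d) hℓ.le]
  exact h2

/-! ### Plancherel for integrable square-integrable functions -/

section Plancherel

variable {F G : Euc d → ℂ}

/-- The L² transform and the Fourier integral agree as distributions: against a test function both
move the transform onto the test function. -/
theorem fourier_toLp_ae_eq (h1 : Integrable F) (h2 : MemLp F 2) :
    ((𝓕 (h2.toLp F) : Lp ℂ 2 (volume : Measure (Euc d))) : Euc d → ℂ) =ᵐ[volume] 𝓕 F := by
  have hcont : Continuous (𝓕 F) :=
    VectorFourier.fourierIntegral_continuous Real.continuous_fourierChar
      continuous_inner h1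
  refine ae_eq_of_integral_contDiff_smul_eq
    ((Lp.memLp (𝓕 (h2.toLp F) : Lp ℂ 2 (volume : Measure (Euc d)))).locallyIntegrable
      one_le_two) hcont.locallyIntegrable ?_
  intro g g_smooth g_cpt
  have hg₁ : HasCompactSupport (Complex.ofRealCLM ∘ g) := g_cpt.comp_left rfl
  have hg₂ : ContDiff ℝ (⊤ : ℕ∞) (Complex.ofRealCLM ∘ g) := by fun_prop
  let φ : SchwartzMap (Euc d) ℂ := hg₁.toSchwartzMap hg₂
  have key := congrArg (fun T => T φ)
    (Lp.fourier_toTemperedDistribution_eq (h2.toLp F : Lp ℂ 2 (volume : Measure (Euc d))))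
  simp only [TemperedDistribution.fourier_apply, Lp.toTemperedDistribution_apply] at key
  have hself : ∫ ξ, 𝓕 (φ : Euc d → ℂ) ξ • F ξ = ∫ x, φ x • 𝓕 F x := by
    have := VectorFourier.integral_fourierIntegral_smul_eq_flip (L := innerₗ (Euc d))
      (μ := volume) (ν := volume) Real.continuous_fourierChar continuous_inner
      (f := (φ : Euc d → ℂ)) (g := F) φ.integrable h1
    rw [flip_innerₗ] at this
    exact this
  calc ∫ x, g x • ((𝓕 (h2.toLp F) : Lp ℂ 2 (volume : Measure (Euc d))) : Euc d → ℂ) x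
      = ∫ x, φ x • ((𝓕 (h2.toLp F) : Lp ℂ 2 (volume : Measure (Euc d))) : Euc d → ℂ) x := by
        simp [φ]
    _ = ∫ ξ, 𝓕 (φ : Euc d → ℂ) ξ • (h2.toLp F : Euc d → ℂ) ξ := key.symm
    _ = ∫ ξ, 𝓕 (φ : Euc d → ℂ) ξ • F ξ := by
        refine integral_congr_ae ?_
        filter_upwards [h2.coeFn_toLp] with x hx
        rw [hx]
    _ = ∫ x, φ x • 𝓕 F x := hself
    _ = ∫ x, g x • 𝓕 F x := by simp [φ]

theorem integral_conj_fourier_mul_fourier (hF1 : Integrable F) (hF2 : MemLp F 2)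
    (hG1 : Integrable G) (hG2 : MemLp G 2) :
    ∫ ξ, conj (𝓕 F ξ) * 𝓕 G ξ = ∫ x, conj (F x) * G x := by
  have h := Lp.inner_fourier_eq (hF2.toLp F : Lp ℂ 2 (volume : Measure (Euc d))) (hG2.toLp G)
  rw [L2.inner_def, L2.inner_def] at h
  have e1 : ∫ ξ, conj (𝓕 F ξ) * 𝓕 G ξ = _ := integral_congr_ae (by
    filter_upwards [fourier_toLp_ae_eq hF1 hF2, fourier_toLp_ae_eq hG1 hG2] with x hx hy
    rw [← hx, ← hy, mul_comm])
  refine (e1.trans h).trans (integral_congr_ae ?_)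
  filter_upwards [hF2.coeFn_toLp, hG2.coeFn_toLp] with x hx hy
  rw [hx, hy, mul_comm]
  rfl

theorem memLp_fourier (hF1 : Integrable F) (hF2 : MemLp F 2) : MemLp (𝓕 F) 2 :=
  (memLp_congr_ae (fourier_toLp_ae_eq hF1 hF2)).1 (Lp.memLp _)

theorem integral_norm_fourier_sq (hF1 : Integrable F) (hF2 : MemLp F 2) :
    ∫ ξ, ‖𝓕 F ξ‖ ^ 2 = ∫ x, ‖F x‖ ^ 2 := by
  have h := integral_conj_fourier_mul_fourier hF1 hF2 hF1 hF2
  simp only [Complex.conj_mul', ← Complex.ofReal_pow] at h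
  have e1 := integral_ofReal (𝕜 := ℂ) (μ := (volume : Measure (Euc d))) (f := fun ξ => ‖𝓕 F ξ‖ ^ 2)
  have e2 := integral_ofReal (𝕜 := ℂ) (μ := (volume : Measure (Euc d))) (f := fun x => ‖F x‖ ^ 2)
  exact Complex.ofReal_injective (e1.symm.trans (h.trans e2))

theorem memLp_two_of_norm_le_one (hF1 : Integrable F) (hb : ∀ x, ‖F x‖ ≤ 1) : MemLp F 2 := by
  rw [memLp_two_iff_integrable_sq_norm hF1.aestronglyMeasurable]
  refine hF1.norm.mono (by fun_prop) (Eventually.of_forall fun x => ?_)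
  rw [Real.norm_of_nonneg (by positivity), norm_norm]
  have := hb x
  have := norm_nonneg (F x)
  nlinarith

end Plancherel

/-! ### Averaging over a measure -/

/-- The average of the translates `x ↦ f (x - v)` for `v` distributed according to `σ`. -/
noncomputable def smear (σ : Measure (Euc d)) (f : Euc d → ℂ) (x : Euc d) : ℂ :=
  ∫ v, f (x - v) ∂σ

section Smear

variable {σ : Measure (Euc d)} [IsProbabilityMeasure σ] {f g : Euc d → ℂ}

theorem integrable_sub_prod (hf : Integrable f) (hm : Measurable f) :
    Integrable (fun p : Euc d × Euc d => f (p.1 - p.2)) (volume.prod σ) := by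
  have hmeas : Measurable (fun p : Euc d × Euc d => f (p.1 - p.2)) :=
    hm.comp (measurable_fst.sub measurable_snd)
  rw [integrable_prod_iff' hmeas.aestronglyMeasurable]
  refine ⟨Eventually.of_forall fun v => hf.comp_sub_right v, ?_⟩
  have h : (fun v : Euc d => ∫ x, ‖f (x - v)‖) = fun _ => ∫ x, ‖f x‖ :=
    funext fun v => integral_sub_right_eq_self (fun x => ‖f x‖) v
  exact h ▸ integrable_const (μ := σ) (∫ x, ‖f x‖)

theorem integrable_smear (hf : Integrable f) (hm : Measurable f) : Integrable (smear σ f) :=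
  (integrable_sub_prod hf hm).integral_prod_left

theorem norm_smear_le_one (hb : ∀ x, ‖f x‖ ≤ 1) (x : Euc d) : ‖smear σ f x‖ ≤ 1 := by
  refine (norm_integral_le_of_norm_le_const (Eventually.of_forall fun v => hb (x - v))).trans ?_
  simp

theorem fourier_smear (hf : Integrable f) (hm : Measurable f) (ξ : Euc d) :
    𝓕 (smear σ f) ξ = measureFourier σ ξ * 𝓕 f ξ := by
  have hint : Integrable (fun p : Euc d × Euc d =>
      Complex.exp (↑(-2 * Real.pi * inner ℝ p.1 ξ) * Complex.I) * f (p.1 - p.2))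
      (volume.prod σ) := by
    refine (integrable_sub_prod (σ := σ) hf hm).bdd_mul (c := 1) ?_ ?_
    · exact (Continuous.aestronglyMeasurable (by fun_prop))
    · exact Eventually.of_forall fun p => (Complex.norm_exp_ofReal_mul_I _).le
  rw [Real.fourier_eq', Real.fourier_eq', measureFourier]
  calc ∫ x, Complex.exp (↑(-2 * Real.pi * inner ℝ x ξ) * Complex.I) • smear σ f x
      = ∫ x, ∫ v, Complex.exp (↑(-2 * Real.pi * inner ℝ x ξ) * Complex.I) * f (x - v) ∂σ := by
        simp only [smear, smul_eq_mul, integral_const_mul]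
    _ = ∫ v, ∫ x, Complex.exp (↑(-2 * Real.pi * inner ℝ x ξ) * Complex.I) * f (x - v) ∂volume ∂σ :=
        integral_integral_swap hint
    _ = ∫ v, Complex.exp (-(2 * Real.pi * (inner ℝ v ξ : ℝ) : ℂ) * Complex.I) *
          (∫ x, Complex.exp (↑(-2 * Real.pi * inner ℝ x ξ) * Complex.I) • f x) ∂σ := by
        congr 1
        ext v
        rw [← integral_const_mul, ← integral_sub_right_eq_self (fun x => _ * (_ • f x)) v]
        congr 1
        ext x
        rw [smul_eq_mul, ← mul_assoc, ← Complex.exp_add]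
        congr 2
        rw [inner_sub_left]
        push_cast
        ring
    _ = _ := by rw [integral_mul_const]

theorem integral_conj_mul_smear (hf : Integrable f) (hm : Measurable f) (hb : ∀ x, ‖f x‖ ≤ 1)
    (hg : Integrable g) (hgb : ∀ x, ‖g x‖ ≤ 1) :
    ∫ x, conj (g x) * smear σ f x = ∫ ξ, conj (𝓕 g ξ) * (measureFourier σ ξ * 𝓕 f ξ) := by
  have h1 := integrable_smear (σ := σ) hf hm
  rw [← integral_conj_fourier_mul_fourier hg (memLp_two_of_norm_le_one hg hgb) h1
    (memLp_two_of_norm_le_one h1 (norm_smear_le_one hb))]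
  simp only [fourier_smear hf hm]

theorem continuous_measureFourier : Continuous (measureFourier σ) := by
  unfold measureFourier
  refine continuous_of_dominated (bound := fun _ => 1) ?_ ?_ (integrable_const _) ?_
  · exact fun ξ => Continuous.aestronglyMeasurable (by fun_prop)
  · refine fun ξ => Eventually.of_forall fun x => ?_
    have : (-(2 * Real.pi * (inner ℝ x ξ : ℝ) : ℂ) * Complex.I) =
      ((-(2 * Real.pi * inner ℝ x ξ) : ℝ) : ℂ) * Complex.I := by push_cast; ring
    rw [this, Complex.norm_exp_ofReal_mul_I]
  · exact Eventually.of_forall fun x => by fun_prop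

theorem norm_measureFourier_le_one (ξ : Euc d) : ‖measureFourier σ ξ‖ ≤ 1 := by
  refine (norm_integral_le_of_norm_le_const (C := 1) (Eventually.of_forall fun x => ?_)).trans ?_
  · have : (-(2 * Real.pi * (inner ℝ x ξ : ℝ) : ℂ) * Complex.I) =
      ((-(2 * Real.pi * inner ℝ x ξ) : ℝ) : ℂ) * Complex.I := by push_cast; ring
    rw [this, Complex.norm_exp_ofReal_mul_I]
  · simp

end Smear

/-! ### Weak continuity of the pair count -/

section WeakContinuity

variable {σ : Measure (Euc d)}

/-- Measurable functions with values in the closed unit disc, vanishing outside `Q`. -/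
structure UnitFunction (Q : Set (Euc d)) (f : Euc d → ℂ) : Prop where
  measurable : Measurable f
  norm_le_one : ∀ x, ‖f x‖ ≤ 1
  eq_zero : ∀ x ∉ Q, f x = 0

variable {Q : Set (Euc d)}

theorem UnitFunction.norm_le_indicator {f : Euc d → ℂ} (hf : UnitFunction Q f) (x : Euc d) :
    ‖f x‖ ≤ Q.indicator (fun _ => (1 : ℝ)) x := by
  by_cases hx : x ∈ Q
  · simpa [hx] using hf.norm_le_one x
  · simp [hx, hf.eq_zero x hx]

theorem UnitFunction.integrable {f : Euc d → ℂ} (hf : UnitFunction Q f) (hQ : MeasurableSet Q)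
    (hQf : volume Q ≠ ⊤) : Integrable f :=
  ((integrable_indicator_iff hQ).2 (integrableOn_const hQf)).mono'
    hf.measurable.aestronglyMeasurable (Eventually.of_forall hf.norm_le_indicator)

theorem UnitFunction.integral_norm_sq_le {f : Euc d → ℂ} (hf : UnitFunction Q f)
    (hQ : MeasurableSet Q) (hQf : volume Q ≠ ⊤) : ∫ x, ‖f x‖ ^ 2 ≤ volume.real Q := by
  have h1 : ∫ x, Q.indicator (fun _ => (1 : ℝ)) x = volume.real Q := by
    rw [integral_indicator_const _ hQ]; simp
  rw [← h1]
  refine integral_mono_of_nonneg (Eventually.of_forall fun x => by positivity)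
    ((integrable_indicator_iff hQ).2 (integrableOn_const hQf)) (Eventually.of_forall fun x => ?_)
  have h2 := hf.norm_le_indicator x
  have h3 := hf.norm_le_one x
  have h4 := norm_nonneg (f x)
  simp only
  nlinarith

theorem UnitFunction.norm_fourier_le {f : Euc d → ℂ} (hf : UnitFunction Q f)
    (hQ : MeasurableSet Q) (hQf : volume Q ≠ ⊤) (ξ : Euc d) : ‖𝓕 f ξ‖ ≤ volume.real Q := by
  refine (VectorFourier.norm_fourierIntegral_le_integral_norm _ _ _ _ _).trans ?_
  have h1 : ∫ x, Q.indicator (fun _ => (1 : ℝ)) x = volume.real Q := by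
    rw [integral_indicator_const _ hQ]; simp
  rw [← h1]
  exact integral_mono_of_nonneg (Eventually.of_forall fun x => norm_nonneg _)
    ((integrable_indicator_iff hQ).2 (integrableOn_const hQf))
    (Eventually.of_forall hf.norm_le_indicator)

/-- AM-GM followed by Plancherel. The bound is uniform in f and g, which is what makes the high
frequencies negligible along a whole sequence. -/
theorem norm_setIntegral_fourier_le {f g : Euc d → ℂ} (hf : UnitFunction Q f)
    (hg : UnitFunction Q g) (hQ : MeasurableSet Q) (hQf : volume Q ≠ ⊤) {S : Set (Euc d)}
    (hS : MeasurableSet S) {η : ℝ} (hη : ∀ ξ ∈ S, ‖measureFourier σ ξ‖ ≤ η) (hη0 : 0 ≤ η) :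
    ‖∫ ξ in S, conj (𝓕 g ξ) * (measureFourier σ ξ * 𝓕 f ξ)‖ ≤ η * volume.real Q := by
  have hf1 := hf.integrable hQ hQf
  have hg1 := hg.integrable hQ hQf
  have hf2 := memLp_two_of_norm_le_one hf1 hf.norm_le_one
  have hg2 := memLp_two_of_norm_le_one hg1 hg.norm_le_one
  have hfi : Integrable fun ξ => ‖𝓕 f ξ‖ ^ 2 := (memLp_fourier hf1 hf2).integrable_norm_pow (by simp)
  have hgi : Integrable fun ξ => ‖𝓕 g ξ‖ ^ 2 := (memLp_fourier hg1 hg2).integrable_norm_pow (by simp)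
  have hsum : Integrable fun ξ => η / 2 * (‖𝓕 g ξ‖ ^ 2 + ‖𝓕 f ξ‖ ^ 2) := (hgi.add hfi).const_mul _
  calc ‖∫ ξ in S, conj (𝓕 g ξ) * (measureFourier σ ξ * 𝓕 f ξ)‖
      ≤ ∫ ξ in S, η / 2 * (‖𝓕 g ξ‖ ^ 2 + ‖𝓕 f ξ‖ ^ 2) := by
        refine norm_integral_le_of_norm_le hsum.integrableOn ?_
        filter_upwards [ae_restrict_mem hS] with ξ hξ
        rw [norm_mul, norm_mul, RCLike.norm_conj]
        have h1 := hη ξ hξ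
        have h2 := norm_nonneg (𝓕 g ξ)
        have h3 := norm_nonneg (𝓕 f ξ)
        have h4 : ‖measureFourier σ ξ‖ * (‖𝓕 g ξ‖ * ‖𝓕 f ξ‖) ≤ η * (‖𝓕 g ξ‖ * ‖𝓕 f ξ‖) := by
          gcongr
        have h5 : η * (2 * (‖𝓕 g ξ‖ * ‖𝓕 f ξ‖)) ≤ η * (‖𝓕 g ξ‖ ^ 2 + ‖𝓕 f ξ‖ ^ 2) := by
          gcongr
          nlinarith [sq_nonneg (‖𝓕 g ξ‖ - ‖𝓕 f ξ‖)]
        linarith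
    _ ≤ ∫ ξ, η / 2 * (‖𝓕 g ξ‖ ^ 2 + ‖𝓕 f ξ‖ ^ 2) :=
        setIntegral_le_integral hsum (Eventually.of_forall fun ξ => by positivity)
    _ = η / 2 * ((∫ x, ‖g x‖ ^ 2) + ∫ x, ‖f x‖ ^ 2) := by
        rw [integral_const_mul, integral_add hgi hfi, integral_norm_fourier_sq hf1 hf2,
          integral_norm_fourier_sq hg1 hg2]
    _ ≤ η / 2 * (volume.real Q + volume.real Q) := by
        gcongr
        · exact hg.integral_norm_sq_le hQ hQf
        · exact hf.integral_norm_sq_le hQ hQf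
    _ = _ := by ring

theorem integrable_fourier_pair [IsProbabilityMeasure σ] {f g : Euc d → ℂ} (hf : UnitFunction Q f)
    (hg : UnitFunction Q g) (hQ : MeasurableSet Q) (hQf : volume Q ≠ ⊤) :
    Integrable fun ξ => conj (𝓕 g ξ) * (measureFourier σ ξ * 𝓕 f ξ) := by
  have hf1 := hf.integrable hQ hQf
  have hg1 := hg.integrable hQ hQf
  have hf2 := memLp_fourier hf1 (memLp_two_of_norm_le_one hf1 hf.norm_le_one)
  have hg2 := memLp_fourier hg1 (memLp_two_of_norm_le_one hg1 hg.norm_le_one)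
  have hg3 : MemLp (fun ξ => conj (𝓕 g ξ)) 2 := hg2.star
  have h := (hg3.integrable_mul hf2).bdd_mul (c := 1) (f := measureFourier σ)
    continuous_measureFourier.aestronglyMeasurable
    (Eventually.of_forall norm_measureFourier_le_one)
  refine h.congr (Eventually.of_forall fun ξ => ?_)
  simp only [Pi.mul_apply]
  ring

/-- A bilinear expression is not weakly continuous in general (take σ a point mass at 0). Here decay
of the Fourier transform of σ makes the frequencies outside a ball uniformly small, while inside the
ball pointwise convergence of the transforms is enough by dominated convergence. -/
theorem tendsto_integral_conj_mul_smear [IsProbabilityMeasure σ]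
    (hσ : Tendsto (measureFourier σ) (comap norm atTop) (𝓝 0))
    (hQ : MeasurableSet Q) (hQf : volume Q ≠ ⊤) {f g : ℕ → Euc d → ℂ} {f' g' : Euc d → ℂ}
    (hf : ∀ n, UnitFunction Q (f n)) (hg : ∀ n, UnitFunction Q (g n))
    (hf' : UnitFunction Q f') (hg' : UnitFunction Q g')
    (hfl : ∀ ξ, Tendsto (fun n => 𝓕 (f n) ξ) atTop (𝓝 (𝓕 f' ξ)))
    (hgl : ∀ ξ, Tendsto (fun n => 𝓕 (g n) ξ) atTop (𝓝 (𝓕 g' ξ))) :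
    Tendsto (fun n => ∫ x, conj (g n x) * smear σ (f n) x) atTop
      (𝓝 (∫ x, conj (g' x) * smear σ f' x)) := by
  have e : ∀ {f g : Euc d → ℂ}, UnitFunction Q f → UnitFunction Q g →
      ∫ x, conj (g x) * smear σ f x = ∫ ξ, conj (𝓕 g ξ) * (measureFourier σ ξ * 𝓕 f ξ) :=
    fun hf hg => integral_conj_mul_smear (hf.integrable hQ hQf) hf.measurable hf.norm_le_one
      (hg.integrable hQ hQf) hg.norm_le_one
  simp only [e (hf _) (hg _), e hf' hg']
  rw [Metric.tendsto_atTop']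
  intro ε hε
  set V := volume.real Q with hV
  have hV0 : 0 ≤ V := measureReal_nonneg
  -- The two tails and the low-frequency difference each get ε/4; the `+ 1` guards against V = 0.
  set η := ε / (4 * (V + 1)) with hη
  have hη0 : 0 < η := by positivity
  have hηV : η * V ≤ ε / 4 := by
    rw [hη, div_mul_eq_mul_div, div_le_div_iff₀ (by positivity) (by positivity)]
    nlinarith
  obtain ⟨M, hM⟩ : ∃ M : ℝ, ∀ ξ : Euc d, M ≤ ‖ξ‖ → ‖measureFourier σ ξ‖ ≤ η := by
    have h1 := (hσ.norm.eventually_le_const (u := η) (by simpa using hη0))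
    rw [eventually_comap, eventually_atTop] at h1
    obtain ⟨M, hM⟩ := h1
    exact ⟨M, fun ξ hξ => hM _ hξ ξ rfl⟩
  set B := Metric.ball (0 : Euc d) M with hB
  have hBm : MeasurableSet B := measurableSet_ball
  have hsplit : ∀ {f g : Euc d → ℂ}, UnitFunction Q f → UnitFunction Q g →
      ∫ ξ, conj (𝓕 g ξ) * (measureFourier σ ξ * 𝓕 f ξ) =
      (∫ ξ in B, conj (𝓕 g ξ) * (measureFourier σ ξ * 𝓕 f ξ)) +
      ∫ ξ in Bᶜ, conj (𝓕 g ξ) * (measureFourier σ ξ * 𝓕 f ξ) := fun hf hg =>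
    (integral_add_compl hBm (integrable_fourier_pair hf hg hQ hQf)).symm
  have htail : ∀ {f g : Euc d → ℂ}, UnitFunction Q f → UnitFunction Q g →
      ‖∫ ξ in Bᶜ, conj (𝓕 g ξ) * (measureFourier σ ξ * 𝓕 f ξ)‖ ≤ ε / 4 := fun hf hg =>
    (norm_setIntegral_fourier_le hf hg hQ hQf hBm.compl
      (fun ξ hξ => hM ξ (by simpa [hB] using hξ)) hη0.le).trans hηV
  have hmain : Tendsto (fun n => ∫ ξ in B, conj (𝓕 (g n) ξ) * (measureFourier σ ξ * 𝓕 (f n) ξ))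
      atTop (𝓝 (∫ ξ in B, conj (𝓕 g' ξ) * (measureFourier σ ξ * 𝓕 f' ξ))) := by
    refine tendsto_integral_of_dominated_convergence (fun _ => V * (1 * V)) ?_ ?_ ?_ ?_
    · exact fun n => (integrable_fourier_pair (hf n) (hg n) hQ hQf).aestronglyMeasurable.restrict
    · exact integrableOn_const (measure_ball_lt_top).ne
    · refine fun n => Eventually.of_forall fun ξ => ?_
      rw [norm_mul, norm_mul, RCLike.norm_conj]
      have h1 := (hg n).norm_fourier_le hQ hQf ξ
      have h2 := (hf n).norm_fourier_le hQ hQf ξ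
      have h3 := norm_measureFourier_le_one (σ := σ) ξ
      gcongr
    · refine Eventually.of_forall fun ξ => ?_
      exact ((Complex.continuous_conj.tendsto _).comp (hgl ξ)).mul (tendsto_const_nhds.mul (hfl ξ))
  obtain ⟨N, hN⟩ := Metric.tendsto_atTop'.1 hmain (ε / 4) (by positivity)
  refine ⟨N, fun n hn => ?_⟩
  have h1 := hN n hn
  have h2 := htail (hf n) (hg n)
  have h3 := htail hf' hg'
  rw [hsplit (hf n) (hg n), hsplit hf' hg', dist_eq_norm]
  rw [dist_eq_norm] at h1
  calc _ = ‖((∫ ξ in B, conj (𝓕 (g n) ξ) * (measureFourier σ ξ * 𝓕 (f n) ξ)) -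
        ∫ ξ in B, conj (𝓕 g' ξ) * (measureFourier σ ξ * 𝓕 f' ξ)) +
        ((∫ ξ in Bᶜ, conj (𝓕 (g n) ξ) * (measureFourier σ ξ * 𝓕 (f n) ξ)) -
        ∫ ξ in Bᶜ, conj (𝓕 g' ξ) * (measureFourier σ ξ * 𝓕 f' ξ))‖ := by congr 1; ring
    _ ≤ _ := norm_add_le _ _
    _ ≤ _ + (_ + _) := add_le_add_right (norm_sub_le _ _) _
    _ < ε := by linarith

end WeakContinuity

/-! ### Weak limits of sets -/

/-- Weak convergence of the indicator functions of sets `A n ⊆ Q` to a density `f`, tested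
against square-integrable functions on `Q`. -/
def WeaklyTendsto (Q : Set (Euc d)) (A : ℕ → Set (Euc d)) (f : Euc d → ℝ) : Prop :=
  ∀ h : Euc d → ℝ, MemLp h 2 (volume.restrict Q) →
    Tendsto (fun n => ∫ x in Q, h x * (A n).indicator (fun _ => (1 : ℝ)) x) atTop
      (𝓝 (∫ x in Q, h x * f x))

theorem WeaklyTendsto.comp {Q : Set (Euc d)} {A : ℕ → Set (Euc d)} {f : Euc d → ℝ}
    (h : WeaklyTendsto Q A f) {φ : ℕ → ℕ} (hφ : StrictMono φ) :
    WeaklyTendsto Q (fun n => A (φ n)) f :=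
  fun u hu => (h u hu).comp hφ.tendsto_atTop

/-- Measurable real functions with values in `[0, 1]`, vanishing outside `Q`. -/
structure UnitDensity (Q : Set (Euc d)) (f : Euc d → ℝ) : Prop where
  measurable : Measurable f
  nonneg : ∀ x, 0 ≤ f x
  le_one : ∀ x, f x ≤ 1
  eq_zero : ∀ x ∉ Q, f x = 0

theorem unitDensity_indicator {Q A : Set (Euc d)} (hA : MeasurableSet A) (hAQ : A ⊆ Q) :
    UnitDensity Q (A.indicator fun _ => (1 : ℝ)) where
  measurable := measurable_const.indicator hA
  nonneg := Set.indicator_nonneg fun _ _ => zero_le_one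
  le_one := Set.indicator_le_self' fun _ _ => zero_le_one
  eq_zero _ hx := Set.indicator_of_notMem (fun h => hx (hAQ h)) _

section

variable {Q : Set (Euc d)}

theorem UnitDensity.unitFunction {f : Euc d → ℝ} (hf : UnitDensity Q f) :
    UnitFunction Q fun x => (f x : ℂ) where
  measurable := Complex.measurable_ofReal.comp hf.measurable
  norm_le_one x := by
    rw [Complex.norm_real, Real.norm_of_nonneg (hf.nonneg x)]
    exact hf.le_one x
  eq_zero x hx := by simp [hf.eq_zero x hx]

theorem UnitDensity.integrable {f : Euc d → ℝ} (hf : UnitDensity Q f) (hQ : MeasurableSet Q)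
    (hQf : volume Q ≠ ⊤) : Integrable f := by
  simpa using (hf.unitFunction.integrable hQ hQf).re

/-- Sequential Banach–Alaoglu in L²(Q), identified with its dual. Testing on indicators of
measurable sets carries the bounds 0 and 1 to the limit almost everywhere. -/
theorem exists_weaklyTendsto_subseq (hQf : volume Q ≠ ⊤) (hQ : MeasurableSet Q)
    {A : ℕ → Set (Euc d)} (hA : ∀ n, MeasurableSet (A n)) :
    ∃ (φ : ℕ → ℕ) (f : Euc d → ℝ), StrictMono φ ∧ UnitDensity Q f ∧
      WeaklyTendsto Q (fun n => A (φ n)) f := by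
  set μ := volume.restrict Q with hμ
  have : IsFiniteMeasure μ := ⟨by simpa [hμ] using hQf.lt_top⟩
  let u : ℕ → Lp ℝ 2 μ := fun n => indicatorConstLp 2 (hA n) (measure_ne_top μ _) (1 : ℝ)
  let Λ : ℕ → WeakDual ℝ (Lp ℝ 2 μ) := fun n =>
    StrongDual.toWeakDual (InnerProductSpace.toDual ℝ (Lp ℝ 2 μ) (u n))
  set C : ℝ := μ.real Set.univ ^ (1 / (2 : ℝ)) with hC
  have hΛ : ∀ n, Λ n ∈ WeakDual.toStrongDual ⁻¹' Metric.closedBall (0 : StrongDual ℝ (Lp ℝ 2 μ)) C := by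
    intro n
    simp only [Set.mem_preimage, Metric.mem_closedBall, dist_zero_right]
    change ‖InnerProductSpace.toDual ℝ (Lp ℝ 2 μ) (u n)‖ ≤ C
    rw [LinearIsometryEquiv.norm_map, norm_indicatorConstLp (by norm_num) (by norm_num), norm_one,
      one_mul, hC]
    simp only [ENNReal.toReal_ofNat]
    exact Real.rpow_le_rpow measureReal_nonneg (measureReal_mono (Set.subset_univ _)) (by norm_num)
  have : Fact ((2 : ℝ≥0∞) ≠ ⊤) := ⟨by norm_num⟩
  obtain ⟨Λ', -, φ, hφ, hlim⟩ := WeakDual.isSeqCompact_closedBall ℝ (Lp ℝ 2 μ) 0 C hΛ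
  let w : Lp ℝ 2 μ := (InnerProductSpace.toDual ℝ (Lp ℝ 2 μ)).symm (WeakDual.toStrongDual Λ')
  have hinner : ∀ h : Lp ℝ 2 μ, Tendsto (fun n => inner ℝ (u (φ n)) h) atTop (𝓝 (inner ℝ w h)) := by
    intro h
    have h1 := ((WeakDual.eval_continuous h).tendsto Λ').comp hlim
    have h2 : inner ℝ w h = Λ' h := InnerProductSpace.toDual_symm_apply
    rw [h2]
    exact h1
  have hind : ∀ (h : Euc d → ℝ) (n : ℕ),
      ∫ x in A n, h x ∂μ = ∫ x, h x * (A n).indicator (fun _ => (1 : ℝ)) x ∂μ := by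
    intro h n
    rw [← integral_indicator (hA n)]
    congr 1
    ext x
    by_cases hx : x ∈ A n <;> simp [hx]
  have hweak : ∀ h : Euc d → ℝ, MemLp h 2 μ →
      Tendsto (fun n => ∫ x, h x * (A (φ n)).indicator (fun _ => (1 : ℝ)) x ∂μ) atTop
        (𝓝 (∫ x, h x * w x ∂μ)) := by
    intro h hh
    have h1 := hinner (hh.toLp h)
    have h2 : inner ℝ w (hh.toLp h) = ∫ x, h x * w x ∂μ := by
      rw [L2.inner_def]
      refine integral_congr_ae ?_
      filter_upwards [hh.coeFn_toLp] with x hx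
      rw [hx]
      rfl
    rw [h2] at h1
    refine h1.congr fun n => ?_
    rw [← hind, L2.inner_indicatorConstLp_one]
    refine integral_congr_ae ?_
    filter_upwards [ae_restrict_of_ae hh.coeFn_toLp] with x hx
    rw [hx]
  have hwint : Integrable w μ := (Lp.memLp w).integrable (by norm_num)
  have hset : ∀ E, MeasurableSet E →
      Tendsto (fun n => ∫ x in E, (A (φ n)).indicator (fun _ => (1 : ℝ)) x ∂μ) atTop
        (𝓝 (∫ x in E, w x ∂μ)) := by
    intro E hE
    have h1 := hweak (E.indicator fun _ => 1) (memLp_indicator_const 2 hE 1 (Or.inr (measure_ne_top _ _)))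
    have h2 : ∀ v : Euc d → ℝ, ∫ x, E.indicator (fun _ => (1 : ℝ)) x * v x ∂μ = ∫ x in E, v x ∂μ := by
      intro v
      rw [← integral_indicator hE]
      congr 1
      ext x
      by_cases hx : x ∈ E <;> simp [hx]
    simpa only [h2] using h1
  have hindint : ∀ n, Integrable ((A n).indicator (fun _ => (1 : ℝ))) μ := fun n =>
    (integrable_const 1).indicator (hA n)
  have hw0 : 0 ≤ᵐ[μ] w := by
    refine ae_nonneg_of_forall_setIntegral_nonneg hwint fun E hE _ => ?_
    exact ge_of_tendsto' (hset E hE) fun n =>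
      integral_nonneg fun x => Set.indicator_nonneg (fun _ _ => zero_le_one) x
  have hw1 : w ≤ᵐ[μ] fun _ => (1 : ℝ) := by
    refine ae_le_of_forall_setIntegral_le hwint (integrable_const 1) fun E hE _ => ?_
    refine le_of_tendsto' (hset E hE) fun n => ?_
    exact integral_mono (hindint _).integrableOn (integrable_const 1)
      fun x => Set.indicator_le_self' (fun _ _ => zero_le_one) x
  have hwm : Measurable w := (Lp.stronglyMeasurable w).measurable
  -- Clamping to [0, 1] and cutting off outside Q makes the bounds hold everywhere, without changing
  -- the limit almost everywhere on Q.
  refine ⟨φ, Q.indicator fun x => max 0 (min 1 (w x)), hφ, ⟨?_, ?_, ?_, ?_⟩, ?_⟩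
  · exact (measurable_const.max (measurable_const.min hwm)).indicator hQ
  · exact fun x => Set.indicator_nonneg (fun _ _ => le_max_left _ _) x
  · intro x
    refine (Set.indicator_le_self' (fun _ _ => le_max_left _ _) x).trans ?_
    exact max_le zero_le_one (min_le_left _ _)
  · exact fun x hx => Set.indicator_of_notMem hx _
  · intro h hh
    have h1 : ∫ x, h x * w x ∂μ =
        ∫ x in Q, h x * Q.indicator (fun x => max 0 (min 1 (w x))) x := by
      refine integral_congr_ae ?_
      filter_upwards [hw0, hw1, ae_restrict_mem hQ] with x hx0 hx1 hxQ
      rw [Set.indicator_of_mem hxQ, min_eq_right hx1, max_eq_right (by exact hx0)]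
    rw [← h1]
    exact hweak h hh

/-- Weak convergence is tested on real functions, so the exponential is split into cosine and sine.
-/
theorem UnitDensity.fourier_eq {f : Euc d → ℝ} (hf : UnitDensity Q f) (hQ : MeasurableSet Q)
    (hQf : volume Q ≠ ⊤) (ξ : Euc d) :
    𝓕 (fun x => (f x : ℂ)) ξ =
      ((∫ x in Q, Real.cos (-2 * Real.pi * inner ℝ x ξ) * f x : ℝ) : ℂ) +
      ((∫ x in Q, Real.sin (-2 * Real.pi * inner ℝ x ξ) * f x : ℝ) : ℂ) * Complex.I := by
  have hfi := (hf.integrable hQ hQf).integrableOn (s := Q)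
  have hc : IntegrableOn (fun x => Real.cos (-2 * Real.pi * inner ℝ x ξ) * f x) Q :=
    hfi.bdd_mul (c := 1) (Continuous.aestronglyMeasurable (by fun_prop))
      (Eventually.of_forall fun x => Real.abs_cos_le_one _)
  have hs : IntegrableOn (fun x => Real.sin (-2 * Real.pi * inner ℝ x ξ) * f x) Q :=
    hfi.bdd_mul (c := 1) (Continuous.aestronglyMeasurable (by fun_prop))
      (Eventually.of_forall fun x => Real.abs_sin_le_one _)
  have e1 := integral_ofReal (𝕜 := ℂ) (μ := volume.restrict Q)
    (f := fun x => Real.cos (-2 * Real.pi * inner ℝ x ξ) * f x)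
  have e2 := integral_ofReal (𝕜 := ℂ) (μ := volume.restrict Q)
    (f := fun x => Real.sin (-2 * Real.pi * inner ℝ x ξ) * f x)
  have hc' : IntegrableOn (fun x => ((Real.cos (-2 * Real.pi * inner ℝ x ξ) * f x : ℝ) : ℂ)) Q :=
    hc.ofReal
  have hs' : IntegrableOn (fun x => ((Real.sin (-2 * Real.pi * inner ℝ x ξ) * f x : ℝ) : ℂ)) Q :=
    hs.ofReal
  refine Eq.trans ?_ (congrArg₂ (fun a b : ℂ => a + b * Complex.I) e1 e2)
  refine Eq.trans ?_ (congrArg _ (integral_mul_const Complex.I _))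
  refine Eq.trans ?_ (integral_add hc' (hs'.mul_const Complex.I))
  rw [Real.fourier_eq', ← setIntegral_eq_integral_of_forall_compl_eq_zero (s := Q)]
  · congr 1
    ext x
    change _ = ((Real.cos (-2 * Real.pi * inner ℝ x ξ) * f x : ℝ) : ℂ) +
      ((Real.sin (-2 * Real.pi * inner ℝ x ξ) * f x : ℝ) : ℂ) * Complex.I
    rw [Complex.exp_mul_I, smul_eq_mul]
    push_cast
    ring
  · intro x hx
    simp [hf.eq_zero x hx]

theorem WeaklyTendsto.tendsto_fourier {A : ℕ → Set (Euc d)} {f : Euc d → ℝ}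
    (h : WeaklyTendsto Q A f) (hf : UnitDensity Q f) (hA : ∀ n, MeasurableSet (A n))
    (hAQ : ∀ n, A n ⊆ Q) (hQ : MeasurableSet Q) (hQf : volume Q ≠ ⊤) (ξ : Euc d) :
    Tendsto (fun n => 𝓕 (fun x => (((A n).indicator (fun _ => (1 : ℝ)) x : ℝ) : ℂ)) ξ) atTop
      (𝓝 (𝓕 (fun x => (f x : ℂ)) ξ)) := by
  have : IsFiniteMeasure (volume.restrict Q) := ⟨by simpa using hQf.lt_top⟩
  simp only [(unitDensity_indicator (hA _) (hAQ _)).fourier_eq hQ hQf, hf.fourier_eq hQ hQf]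
  have hc := h (fun x => Real.cos (-2 * Real.pi * inner ℝ x ξ)) (MemLp.of_bound
    (Continuous.aestronglyMeasurable (by fun_prop)) 1
    (Eventually.of_forall fun x => Real.abs_cos_le_one _))
  have hs := h (fun x => Real.sin (-2 * Real.pi * inner ℝ x ξ)) (MemLp.of_bound
    (Continuous.aestronglyMeasurable (by fun_prop)) 1
    (Eventually.of_forall fun x => Real.abs_sin_le_one _))
  exact ((Complex.continuous_ofReal.tendsto _).comp hc).add
    (((Complex.continuous_ofReal.tendsto _).comp hs).mul_const _)

theorem WeaklyTendsto.tendsto_volume_inter {A : ℕ → Set (Euc d)} {f : Euc d → ℝ}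
    (h : WeaklyTendsto Q A f) (hA : ∀ n, MeasurableSet (A n)) (hQf : volume Q ≠ ⊤)
    {E : Set (Euc d)} (hE : MeasurableSet E) (hEQ : E ⊆ Q) :
    Tendsto (fun n => volume.real (A n ∩ E)) atTop (𝓝 (∫ x in E, f x)) := by
  have : IsFiniteMeasure (volume.restrict Q) := ⟨by simpa using hQf.lt_top⟩
  have h1 := h (E.indicator fun _ => 1)
    (memLp_indicator_const 2 hE 1 (Or.inr (measure_ne_top _ _)))
  have h2 : ∀ v : Euc d → ℝ,
      ∫ x in Q, E.indicator (fun _ => (1 : ℝ)) x * v x = ∫ x in E, v x := by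
    intro v
    have : (fun x => E.indicator (fun _ => (1 : ℝ)) x * v x) = E.indicator v := by
      ext x
      by_cases hx : x ∈ E <;> simp [hx]
    rw [this, setIntegral_indicator hE, Set.inter_eq_right.2 hEQ]
  simp only [h2] at h1
  refine h1.congr fun n => ?_
  rw [setIntegral_indicator (hA n), Set.inter_comm]
  simp

end

/-! ### Pairs of density points -/

theorem exists_density_points {S : Set (Euc d)} (hS : MeasurableSet S) :
    ∃ S' ⊆ S, MeasurableSet S' ∧ volume (S \ S') = 0 ∧ ∀ x ∈ S', ∀ c < (1 : ℝ),
      ∀ᶠ r in 𝓝[>] (0 : ℝ), c * volume.real (Metric.closedBall x r) <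
        volume.real (S ∩ Metric.closedBall x r) := by
  have hae := Besicovitch.ae_tendsto_measure_inter_div (volume : Measure (Euc d)) S
  rw [ae_restrict_iff' hS] at hae
  set N := {x | ¬ (x ∈ S → Tendsto (fun r => volume (S ∩ Metric.closedBall x r) /
    volume (Metric.closedBall x r)) (𝓝[>] 0) (𝓝 1))} with hN
  have hN0 : volume N = 0 := hae
  refine ⟨S \ toMeasurable volume N, Set.sdiff_subset, hS.diff (measurableSet_toMeasurable _ _),
    ?_, ?_⟩
  · refine measure_mono_null ?_ ((measure_toMeasurable N).trans hN0)
    intro x hx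
    by_contra h
    exact hx.2 ⟨hx.1, h⟩
  · rintro x ⟨hxS, hxN⟩ c hc
    have hx : Tendsto (fun r => volume (S ∩ Metric.closedBall x r) /
        volume (Metric.closedBall x r)) (𝓝[>] 0) (𝓝 1) := by
      by_contra h
      exact hxN (subset_toMeasurable _ _ fun h' => h (h' hxS))
    rcases lt_or_ge c 0 with hc0 | hc0
    · filter_upwards [self_mem_nhdsWithin] with r hr
      refine (mul_neg_of_neg_of_pos hc0 ?_).trans_le measureReal_nonneg
      exact ENNReal.toReal_pos (Metric.measure_closedBall_pos volume x hr).ne'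
        measure_closedBall_lt_top.ne
    · have h1 : ENNReal.ofReal c < 1 := by rwa [ENNReal.ofReal_lt_one]
      filter_upwards [hx.eventually_const_lt h1, self_mem_nhdsWithin] with r hr hr0
      have hV0 := (Metric.measure_closedBall_pos volume x hr0).ne'
      have hV1 : volume (Metric.closedBall x r) ≠ ⊤ := measure_closedBall_lt_top.ne
      rw [ENNReal.lt_div_iff_mul_lt (Or.inl hV0) (Or.inl hV1)] at hr
      have h2 := ENNReal.toReal_strict_mono
        ((measure_mono Set.inter_subset_right).trans_lt hV1.lt_top).ne hr
      rwa [ENNReal.toReal_mul, ENNReal.toReal_ofReal hc0] at h2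

/-- Keep only density points. If x - y were in the support, σ would charge every ball about it, so
some v within r of x - y would make S and T + v almost disjoint. Near x, however, both are too dense
for that. -/
theorem exists_subsets_no_pairs {σ : Measure (Euc d)} {S T : Set (Euc d)} (hS : MeasurableSet S)
    (hT : MeasurableSet T) (h : ∀ᵐ v ∂σ, volume (S ∩ (fun x => x - v) ⁻¹' T) = 0) :
    ∃ S' ⊆ S, ∃ T' ⊆ T, MeasurableSet S' ∧ MeasurableSet T' ∧ volume (S \ S') = 0 ∧
      volume (T \ T') = 0 ∧ ∀ x ∈ S', ∀ y ∈ T', x - y ∉ σ.support := by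
  obtain ⟨S', hS'S, hS', hS0, hSd⟩ := exists_density_points hS
  obtain ⟨T', hT'T, hT', hT0, hTd⟩ := exists_density_points hT
  refine ⟨S', hS'S, T', hT'T, hS', hT', hS0, hT0, fun x hx y hy hxy => ?_⟩
  have h2pos : Tendsto (fun r : ℝ => 2 * r) (𝓝[>] 0) (𝓝[>] 0) := by
    refine tendsto_nhdsWithin_iff.2 ⟨?_, ?_⟩
    · have : Tendsto (fun r : ℝ => 2 * r) (𝓝 0) (𝓝 (2 * 0)) := (continuous_const_mul 2).tendsto 0
      rw [mul_zero] at this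
      exact this.mono_left nhdsWithin_le_nhds
    · filter_upwards [self_mem_nhdsWithin] with r hr
      have : (0 : ℝ) < r := hr
      simpa using this
  -- With V the volume of an r-ball, S misses less than V/2 of the 2r-ball about x, while the
  -- translate of T fills more than V/2 of that same ball.
  have hc : 1 - ((2 : ℝ) ^ d)⁻¹ / 2 < 1 := by
    have : (0 : ℝ) < ((2 : ℝ) ^ d)⁻¹ := by positivity
    linarith
  obtain ⟨r, hr1, hr2, hr0⟩ := ((hTd y hy (1 / 2) (by norm_num)).and
    ((h2pos.eventually (hSd x hx _ hc)).and self_mem_nhdsWithin)).exists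
  replace hr0 : 0 < r := hr0
  have hσpos : 0 < σ (Metric.ball (x - y) r) :=
    (Measure.mem_support_iff_forall _).1 hxy _ (Metric.ball_mem_nhds _ hr0)
  obtain ⟨v, hv, hv0⟩ : ∃ v ∈ Metric.ball (x - y) r, volume (S ∩ (fun x => x - v) ⁻¹' T) = 0 := by
    by_contra! hcon
    refine hσpos.ne' (measure_mono_null ?_ h)
    exact fun v hv => hcon v hv
  set V := volume.real (Metric.closedBall y r) with hV
  have hV2 : volume.real (Metric.closedBall x (2 * r)) = 2 ^ d * V := by
    rw [hV, Measure.real, Measure.real, Measure.addHaar_closedBall _ _ (by positivity),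
      Measure.addHaar_closedBall _ _ hr0.le, ENNReal.toReal_mul, ENNReal.toReal_mul,
      ENNReal.toReal_ofReal (by positivity), ENNReal.toReal_ofReal (by positivity)]
    simp only [finrank_euclideanSpace, Fintype.card_fin]
    ring
  rw [hV2] at hr2
  set T₁ := (fun x => x - v) ⁻¹' (T ∩ Metric.closedBall y r) with hT₁
  have hT₁v : volume.real T₁ = volume.real (T ∩ Metric.closedBall y r) := by
    rw [hT₁, Measure.real, volume_preimage_sub_const, Measure.real]
  have hT₁m : MeasurableSet T₁ := (measurable_sub_const v) (hT.inter measurableSet_closedBall)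
  have hT₁s : T₁ ⊆ Metric.closedBall x (2 * r) := by
    rintro z ⟨-, hz⟩
    rw [Metric.mem_closedBall, dist_eq_norm] at hz ⊢
    rw [Metric.mem_ball, dist_eq_norm] at hv
    calc ‖z - x‖ = ‖(z - v - y) + (v - (x - y))‖ := by congr 1; abel
      _ ≤ _ := norm_add_le _ _
      _ ≤ 2 * r := by linarith
  have hdisj : AEDisjoint volume (S ∩ Metric.closedBall x (2 * r)) T₁ := by
    refine measure_mono_null ?_ hv0
    rintro z ⟨⟨h1, -⟩, h2, -⟩
    exact ⟨h1, h2⟩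
  have hunion : volume.real (S ∩ Metric.closedBall x (2 * r)) + volume.real T₁ ≤
      volume.real (Metric.closedBall x (2 * r)) := by
    rw [← measureReal_union₀ hT₁m.nullMeasurableSet hdisj
      ((measure_mono Set.inter_subset_right).trans_lt measure_closedBall_lt_top).ne
      ((measure_mono hT₁s).trans_lt measure_closedBall_lt_top).ne]
    exact measureReal_mono (Set.union_subset Set.inter_subset_right hT₁s)
      measure_closedBall_lt_top.ne
  rw [hV2, hT₁v] at hunion
  have e : (1 - ((2 : ℝ) ^ d)⁻¹ / 2) * (2 ^ d * V) = 2 ^ d * V - 1 / 2 * V := by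
    have : (2 : ℝ) ^ d ≠ 0 := by positivity
    field_simp
  linarith

/-- By Fubini the pair count is the integral of the nonnegative function g(x) f(x - v), which must
therefore vanish almost everywhere. -/
theorem ae_volume_inter_eq_zero {σ : Measure (Euc d)} [IsProbabilityMeasure σ] {Q : Set (Euc d)}
    {f g : Euc d → ℝ} (hf : UnitDensity Q f) (hg : UnitDensity Q g) (hQ : MeasurableSet Q)
    (hQf : volume Q ≠ ⊤)
    (h : ∫ x, conj (g x : ℂ) * smear σ (fun x => (f x : ℂ)) x = 0) :
    ∀ᵐ v ∂σ, volume ({x | 0 < g x} ∩ (fun x => x - v) ⁻¹' {x | 0 < f x}) = 0 := by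
  have hint : Integrable (fun p : Euc d × Euc d => f (p.1 - p.2)) (volume.prod σ) := by
    have := integrable_sub_prod (σ := σ) (hf.unitFunction.integrable hQ hQf)
      hf.unitFunction.measurable
    simpa using this.re
  have hint2 : Integrable (fun p : Euc d × Euc d => g p.1 * f (p.1 - p.2)) (volume.prod σ) := by
    refine hint.bdd_mul (c := 1) ?_ (Eventually.of_forall fun p => ?_)
    · exact (hg.measurable.comp measurable_fst).aestronglyMeasurable
    · rw [Real.norm_of_nonneg (hg.nonneg _)]; exact hg.le_one _
  have h0 : ∫ p, g p.1 * f (p.1 - p.2) ∂(volume.prod σ) = 0 := by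
    rw [integral_prod _ hint2]
    refine Complex.ofReal_injective ?_
    rw [Complex.ofReal_zero, ← h]
    refine (integral_ofReal (𝕜 := ℂ)).symm.trans ?_
    congr 1
    ext x
    have e : ∫ y, g (x, y).1 * f ((x, y).1 - (x, y).2) ∂σ = g x * ∫ y, f (x - y) ∂σ :=
      integral_const_mul (g x) fun y => f (x - y)
    rw [Complex.conj_ofReal, smear]
    refine (congrArg _ e).trans ?_
    refine (Complex.ofReal_mul _ _).trans ?_
    exact congrArg _ (integral_ofReal (𝕜 := ℂ)).symm
  rw [integral_eq_zero_iff_of_nonneg (fun p => mul_nonneg (hg.nonneg _) (hf.nonneg _)) hint2] at h0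
  have h1 := Measure.ae_ae_of_ae_prod ((Measure.measurePreserving_swap (μ := σ)
    (ν := (volume : Measure (Euc d)))).quasiMeasurePreserving.ae h0)
  filter_upwards [h1] with v hv
  refine measure_mono_null ?_ hv
  rintro x ⟨hx1, hx2⟩ hx
  have : 0 < g x * f (x - v) := mul_pos hx1 hx2
  exact this.ne' hx

/-! ### Structure of the weak limits -/

theorem exists_box_of_isCompact {K : Set (Euc d)} (hK : IsCompact K) :
    ∃ ρ : ℝ, 0 < ρ ∧ ∀ v ∈ K, ∀ i, |v i| < ρ := by
  obtain ⟨C, hC⟩ := hK.isBounded.exists_norm_le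
  refine ⟨max C 0 + 1, by positivity, fun v hv i => ?_⟩
  have h1 : |v i| ≤ ‖v‖ := PiLp.norm_apply_le v i
  have h2 := hC v hv
  have h3 := le_max_left C 0
  linarith

theorem Admissible.neg_mem_support {σ : Measure (Euc d)} (h : Admissible σ) {v : Euc d}
    (hv : v ∈ σ.support) : -v ∈ σ.support := by
  rw [Measure.mem_support_iff_forall] at hv ⊢
  intro U hU
  obtain ⟨O, hOU, hO, hvO⟩ := mem_nhds_iff.1 hU
  refine lt_of_lt_of_le ?_ (measure_mono hOU)
  rw [← h.symmetric O hO.measurableSet]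
  exact hv _ ((hO.preimage continuous_neg).mem_nhds hvO)

/-- The points with a K₂-neighbour in A form A ∩ (A + K₂). Compactness of A is there to make this
set measurable. -/
theorem exists_split_of_setOrAvoiding {K₁ K₂ A : Set (Euc d)} (hA : IsCompact A)
    (hK₂ : IsCompact K₂) (h : SetOrAvoiding K₁ K₂ A) :
    ∃ B ⊆ A, MeasurableSet B ∧ SetAvoiding K₁ (A \ B) ∧ ∀ x ∈ B, ∀ y ∈ A, x - y ∉ K₂ := by
  have hmem : ∀ x, x ∉ A + K₂ ↔ ∀ y ∈ A, x - y ∉ K₂ := by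
    intro x
    rw [Set.mem_add]
    push Not
    constructor
    · exact fun h y hy hxy => h y hy _ hxy (by abel)
    · rintro h y hy k hk rfl
      exact h y hy (by simpa using hk)
  refine ⟨A \ (A + K₂), Set.sdiff_subset, hA.measurableSet.diff (hA.add hK₂).measurableSet, ?_,
    fun x hx => (hmem x).1 hx.2⟩
  rintro x ⟨hx, hx'⟩ y ⟨hy, -⟩
  rcases h x hx with h1 | h1
  · exact h1 y hy
  · exact absurd ⟨hx, (hmem x).2 h1⟩ hx'

theorem smear_indicator_eq_zero {σ : Measure (Euc d)} {A : Set (Euc d)} {x : Euc d}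
    (h : ∀ y ∈ A, x - y ∉ σ.support) :
    smear σ (fun x => ((A.indicator (fun _ => (1 : ℝ)) x : ℝ) : ℂ)) x = 0 := by
  refine integral_eq_zero_of_ae ?_
  filter_upwards [Measure.support_mem_ae (μ := σ)] with v hv
  have : x - v ∉ A := fun hA => h _ hA (by simpa using hv)
  simp [this]

section Limit

variable {Q : Set (Euc d)} {f g : Euc d → ℝ}

theorem setIntegral_le_volume (hf : UnitDensity Q f) (hQ : MeasurableSet Q)
    (hQf : volume Q ≠ ⊤) {E : Set (Euc d)} (hE : volume E ≠ ⊤) :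
    ∫ x in E, f x ≤ volume.real E := by
  calc ∫ x in E, f x ≤ ∫ x in E, (1 : ℝ) :=
        integral_mono (hf.integrable hQ hQf).integrableOn (integrableOn_const hE) hf.le_one
    _ = volume.real E := by simp

theorem setIntegral_le_of_isCompact_le (hf : UnitDensity Q f) (hQ : MeasurableSet Q)
    (hQf : volume Q ≠ ⊤) {m : ℝ} (hm : 0 ≤ m) {C : Set (Euc d)} (hC : MeasurableSet C)
    (hCf : volume C ≠ ⊤)
    (h : ∀ E ⊆ C, IsCompact E → ∫ x in E, f x ≤ m * volume.real E) :
    ∫ x in C, f x ≤ m * volume.real C := by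
  refine le_of_forall_pos_le_add fun η hη => ?_
  obtain ⟨E, hEC, hE, hEη⟩ := hC.exists_isCompact_sdiff_lt hCf
    (ENNReal.ofReal_pos.2 hη).ne'
  have h1 : ∫ x in C \ E, f x ≤ η := by
    have h2 : volume (C \ E) ≠ ⊤ := ((measure_mono Set.sdiff_subset).trans_lt hCf.lt_top).ne
    refine (setIntegral_le_volume hf hQ hQf h2).trans ?_
    exact ENNReal.toReal_le_of_le_ofReal hη.le hEη.le
  have h3 : ∫ x in C, f x = (∫ x in C \ E, f x) + ∫ x in E, f x := by
    rw [← setIntegral_union Set.disjoint_sdiff_left hE.measurableSet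
      (hf.integrable hQ hQf).integrableOn (hf.integrable hQ hQf).integrableOn,
      Set.sdiff_union_of_subset hEC]
  have h4 : m * volume.real E ≤ m * volume.real C :=
    mul_le_mul_of_nonneg_left (measureReal_mono hEC hCf) hm
  linarith [h E hEC hE]

/-- Since g vanishes on E, the sets Bₙ lose all their mass there, and f is the limit of sets
avoiding sₙK. In the window bound, n → ∞ at fixed ℓ kills the corridor width sₙρ; afterwards δ → 0
shrinks the thickening back to the compact set E. -/
theorem setIntegral_le_avoidDensity {K : Set (Euc d)} (hK : IsCompact K) (hQf : volume Q ≠ ⊤)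
    {A B : ℕ → Set (Euc d)} (hA : ∀ n, MeasurableSet (A n)) (hB : ∀ n, MeasurableSet (B n))
    (hBA : ∀ n, B n ⊆ A n) {s : ℕ → ℝ} (hs : ∀ n, 0 < s n) (hs0 : Tendsto s atTop (𝓝 0))
    (hav : ∀ n, SetAvoiding (s n • K) (A n \ B n)) (hf : WeaklyTendsto Q A f)
    (hg : WeaklyTendsto Q B g) {E : Set (Euc d)} (hE : IsCompact E) (hEQ : E ⊆ Q)
    (hgE : ∀ x ∈ E, g x = 0) :
    ∫ x in E, f x ≤ avoidDensity K * volume.real E := by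
  obtain ⟨ρ, hρ, hKρ⟩ := exists_box_of_isCompact hK
  have hm : 0 ≤ avoidDensity K := maxDensity_nonneg _
  have hfE := hf.tendsto_volume_inter hA hQf hE.measurableSet hEQ
  have hgE' := hg.tendsto_volume_inter hB hQf hE.measurableSet hEQ
  rw [setIntegral_congr_fun hE.measurableSet hgE, integral_zero] at hgE'
  have hEf : volume E ≠ ⊤ := hE.measure_lt_top.ne
  have hdiff : Tendsto (fun n => volume.real ((A n \ B n) ∩ E)) atTop (𝓝 (∫ x in E, f x)) := by
    have := hfE.sub hgE'
    rw [sub_zero] at this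
    refine this.congr fun n => ?_
    have h1 : (A n \ B n) ∩ E = (A n ∩ E) \ (B n ∩ E) := by
      ext x; simp only [Set.mem_inter_iff, Set.mem_sdiff]; tauto
    rw [h1, measureReal_sdiff (Set.inter_subset_inter_left _ (hBA n))
      ((hB n).inter hE.measurableSet)
      ((measure_mono Set.inter_subset_right).trans_lt hEf.lt_top).ne]
  have hthick : ∀ δ : ℝ, 0 < δ →
      ∫ x in E, f x ≤ avoidDensity K * volume.real (Metric.thickening δ E) := by
    intro δ hδ
    obtain ⟨ℓ, hℓ, hℓδ⟩ : ∃ ℓ : ℝ, 0 < ℓ ∧ d * ℓ < δ := by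
      refine ⟨δ / (d + 1), by positivity, ?_⟩
      rw [mul_div_assoc', div_lt_iff₀ (by positivity)]
      nlinarith
    have hlim : Tendsto (fun n => avoidDensity K * (ℓ + s n * ρ) ^ d *
        volume.real (Metric.thickening δ E)) atTop
        (𝓝 (avoidDensity K * (ℓ + 0 * ρ) ^ d * volume.real (Metric.thickening δ E))) :=
      ((((hs0.mul_const ρ).const_add ℓ).pow d).const_mul _).mul_const _
    have hle := le_of_tendsto_of_tendsto' (hdiff.mul_const (ℓ ^ d)) hlim fun n => by
      have := volume_inter_le_avoidDensity (K := s n • K) (A := A n \ B n) (E := E) (ℓ := ℓ)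
        (ρ := s n * ρ) (δ := δ) hℓ (mul_pos (hs n) hρ) ?_ ((hA n).diff (hB n))
        hE.measurableSet hE.isBounded (hav n) hℓδ
      · rwa [avoidDensity_smul (hs n)] at this
      · rintro _ ⟨v, hv, rfl⟩ i
        simp only [PiLp.smul_apply, smul_eq_mul, abs_mul, abs_of_pos (hs n)]
        exact mul_lt_mul_of_pos_left (hKρ v hv i) (hs n)
    have hp : 0 < ℓ ^ d := by positivity
    refine le_of_mul_le_mul_right ?_ hp
    rw [zero_mul, add_zero] at hle
    linarith
  have hlim : Tendsto (fun δ : ℝ => volume (Metric.thickening δ E)) (𝓝[>] 0) (𝓝 (volume E)) :=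
    tendsto_measure_thickening_of_isClosed ⟨1, one_pos, hE.isBounded.thickening.measure_lt_top.ne⟩
      hE.isClosed
  have hlim' := ((ENNReal.tendsto_toReal hEf).comp hlim).const_mul (avoidDensity K)
  refine ge_of_tendsto hlim' ?_
  filter_upwards [self_mem_nhdsWithin] with δ hδ using hthick δ hδ

/-- Points of S see nothing in T, so S may be enlarged inside T \ S by any σ-avoiding set. A
well-placed translate of a nearly optimal one fills a fraction close to `avoidDensity σ.support`,
and the union is bounded by periodization. -/
theorem volume_add_le_avoidDensity {σ : Measure (Euc d)} (hσ : Admissible σ) {L ρ : ℝ}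
    (hL : 0 < L) (hρ : 0 < ρ) (hK : ∀ v ∈ σ.support, ∀ i, |v i| < ρ) {S T : Set (Euc d)}
    (hS : MeasurableSet S) (hT : MeasurableSet T) (hSQ : S ⊆ cube 0 L) (hTQ : T ⊆ cube 0 L)
    (hST : volume (S \ T) = 0)
    (h : ∀ᵐ v ∂σ, volume (S ∩ (fun x => x - v) ⁻¹' T) = 0) :
    volume.real S + avoidDensity σ.support * volume.real (T \ S) ≤
      avoidDensity σ.support * (L + ρ) ^ d := by
  obtain ⟨S', hS'S, T', hT'T, hS', hT', hS0, hT0, hpairs⟩ := exists_subsets_no_pairs hS hT h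
  have hSf : volume S ≠ ⊤ := ((measure_mono hSQ).trans_lt (volume_cube_lt_top _ _)).ne
  have hTf : volume T ≠ ⊤ := ((measure_mono hTQ).trans_lt (volume_cube_lt_top _ _)).ne
  -- Excluding differences within U requires its points to lie on both sides of `hpairs`; nothing is
  -- lost in volume, because S is contained in T up to a null set.
  set U := S' ∩ T' with hU
  set C := T' \ S with hC
  have hUv : volume.real U = volume.real S := by
    refine measureReal_congr (ae_eq_set.2 ⟨?_, ?_⟩)
    · exact measure_mono_null (fun x hx => absurd (hS'S hx.1.1) hx.2) measure_empty
    · refine measure_mono_null (t := (S \ S') ∪ (S \ T) ∪ (T \ T')) ?_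
        (measure_union_null (measure_union_null hS0 hST) hT0)
      intro x hx
      simp only [hU, Set.mem_sdiff, Set.mem_inter_iff, Set.mem_union] at hx ⊢
      tauto
  have hCv : volume.real C = volume.real (T \ S) := by
    refine measureReal_congr (ae_eq_set.2 ⟨?_, ?_⟩)
    · exact measure_mono_null (fun x hx => absurd ⟨hT'T hx.1.1, hx.1.2⟩ hx.2) measure_empty
    · refine measure_mono_null ?_ hT0
      intro x hx
      simp only [hC, Set.mem_sdiff] at hx ⊢
      tauto
  have hUm : MeasurableSet U := hS'.inter hT'
  have hCm : MeasurableSet C := hT'.diff hS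
  have hCQ : C ⊆ cube 0 L := fun x hx => hTQ (hT'T hx.1)
  have hsymm : ∀ x ∈ T', ∀ y ∈ S', x - y ∉ σ.support := by
    intro x hx y hy hxy
    have := hσ.neg_mem_support hxy
    rw [neg_sub] at this
    exact hpairs y hy x hx this
  rw [← hCv, ← hUv]
  have key : ∀ a < avoidDensity σ.support,
      volume.real U + a * volume.real C ≤ avoidDensity σ.support * (L + ρ) ^ d := by
    intro a ha
    obtain ⟨D, hD, hDav, hDa⟩ := exists_measurable_lt_upperDensity (P := SetAvoiding σ.support)
      (fun x hx => hx.elim) (fun _ _ => SetAvoiding.mono) ha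
    obtain ⟨z, hz⟩ := exists_translate_of_lt_upperDensity hL hD hCm hCQ hDa
    set W := C ∩ (fun x => x - z) ⁻¹' D with hW
    have hWm : MeasurableSet W := hCm.inter ((measurable_sub_const z) hD)
    have hdisj : Disjoint U W :=
      Set.disjoint_left.2 fun x hx hx' => hx'.1.2 (hS'S hx.1)
    have hWf : volume W ≠ ⊤ := ((measure_mono (Set.inter_subset_left.trans hCQ)).trans_lt
      (volume_cube_lt_top _ _)).ne
    have hUf : volume U ≠ ⊤ := ((measure_mono (Set.inter_subset_left.trans hS'S)).trans_lt
      hSf.lt_top).ne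
    have hav : SetAvoiding σ.support (U ∪ W) := by
      rintro x (hx | hx) y (hy | hy)
      · exact hpairs x hx.1 y hy.2
      · exact hpairs x hx.1 y hy.1.1
      · exact hsymm x hx.1.1 y hy.1
      · exact hDav.preimage_sub z x hx.2 y hy.2
    have hb := volume_le_avoidDensity_of_subset_cube hL hρ hK (hUm.union hWm)
      (Set.union_subset (fun x hx => hSQ (hS'S hx.1)) (Set.inter_subset_left.trans hCQ)) hav
    rw [measureReal_union hdisj hWm hUf hWf] at hb
    linarith
  have hlim : Tendsto (fun a : ℝ => volume.real U + a * volume.real C)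
      (𝓝[<] (avoidDensity σ.support))
      (𝓝 (volume.real U + avoidDensity σ.support * volume.real C)) :=
    Tendsto.mono_left (Continuous.tendsto (by fun_prop) _) nhdsWithin_le_nhds
  refine le_of_tendsto hlim ?_
  filter_upwards [self_mem_nhdsWithin] with a ha using key a ha

/-- On the difference set f integrates to zero, so g does too, although it is positive there. -/
theorem volume_pos_sdiff_eq_zero (hf : UnitDensity Q f) (hg : UnitDensity Q g)
    (hQ : MeasurableSet Q) (hQf : volume Q ≠ ⊤)
    (h : ∀ E ⊆ Q, MeasurableSet E → ∫ x in E, g x ≤ ∫ x in E, f x) :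
    volume ({x | 0 < g x} \ {x | 0 < f x}) = 0 := by
  set E := {x | 0 < g x} \ {x | 0 < f x} with hE
  have hEm : MeasurableSet E := (measurableSet_lt measurable_const hg.measurable).diff
    (measurableSet_lt measurable_const hf.measurable)
  have hEQ : E ⊆ Q := by
    intro x hx
    by_contra hxQ
    have : 0 < g x := hx.1
    exact this.ne' (hg.eq_zero x hxQ)
  have hf0 : ∫ x in E, f x = 0 := by
    rw [setIntegral_congr_fun hEm (g := fun _ => (0 : ℝ)), integral_zero]
    intro x hx
    exact le_antisymm (not_lt.1 hx.2) (hf.nonneg x)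
  have hgi := hg.integrable hQ hQf
  by_contra hne
  have hpos : 0 < ∫ x in E, g x := by
    rw [setIntegral_pos_iff_support_of_nonneg_ae (Eventually.of_forall hg.nonneg) hgi.integrableOn]
    refine (pos_iff_ne_zero.2 hne).trans_le (measure_mono fun x hx => ⟨?_, hx⟩)
    have : 0 < g x := hx.1
    exact this.ne'
  linarith [h E hEQ hEm]

end Limit

/-! ### The limiting argument and the main theorem -/

theorem volume_le_of_setOrAvoiding_seq {σ₁ σ₂ : Measure (Euc d)} (h₁ : IsCompact σ₁.support)
    (h₂ : Admissible σ₂) {L ρ c : ℝ} (hL : 0 < L) (hρ : 0 < ρ)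
    (hK : ∀ v ∈ σ₂.support, ∀ i, |v i| < ρ) {A : ℕ → Set (Euc d)} (hA : ∀ n, IsCompact (A n))
    (hAQ : ∀ n, A n ⊆ cube 0 L) {s : ℕ → ℝ} (hs : ∀ n, 0 < s n) (hs0 : Tendsto s atTop (𝓝 0))
    (hav : ∀ n, SetOrAvoiding (s n • σ₁.support) σ₂.support (A n))
    (hc : ∀ n, c ≤ volume.real (A n)) :
    c ≤ max (avoidDensity σ₁.support) (avoidDensity σ₂.support) * (L + ρ) ^ d := by
  have := h₂.isProbabilityMeasure
  set Q := cube (0 : Euc d) L with hQdef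
  have hQ : MeasurableSet Q := measurableSet_cube _ _
  have hQf : volume Q ≠ ⊤ := (volume_cube_lt_top _ _).ne
  choose B hBA hB hB1 hB2 using fun n =>
    exists_split_of_setOrAvoiding (hA n) h₂.compact_support (hav n)
  obtain ⟨φ, f, hφ, hf, hAf⟩ :=
    exists_weaklyTendsto_subseq hQf hQ fun n => (hA n).measurableSet
  obtain ⟨ψ, g, hψ, hg, hBg⟩ := exists_weaklyTendsto_subseq hQf hQ fun n => hB (φ n)
  replace hAf := hAf.comp hψ
  set θ : ℕ → ℕ := fun n => φ (ψ n) with hθ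
  have hθt : Tendsto θ atTop atTop := hφ.tendsto_atTop.comp hψ.tendsto_atTop
  have hAm : ∀ n, MeasurableSet (A (θ n)) := fun n => (hA _).measurableSet
  have hBQ : ∀ n, B (θ n) ⊆ Q := fun n => (hBA _).trans (hAQ _)
  have hpair : ∫ x, conj (g x : ℂ) * smear σ₂ (fun x => (f x : ℂ)) x = 0 := by
    have hlim := tendsto_integral_conj_mul_smear h₂.fourier_tendsto_zero hQ hQf
      (fun n => (unitDensity_indicator (hAm n) (hAQ _)).unitFunction)
      (fun n => (unitDensity_indicator (hB (θ n)) (hBQ n)).unitFunction)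
      hf.unitFunction hg.unitFunction
      (hAf.tendsto_fourier hf hAm (fun n => hAQ _) hQ hQf)
      (hBg.tendsto_fourier hg (fun n => hB _) hBQ hQ hQf)
    -- Each pair count along the sequence is zero, because points of B have no σ₂-neighbour in A.
    refine tendsto_nhds_unique hlim (tendsto_const_nhds.congr fun n => ?_)
    refine (integral_eq_zero_of_ae (Eventually.of_forall fun x => ?_)).symm
    by_cases hx : x ∈ B (θ n)
    · simp [smear_indicator_eq_zero (hB2 (θ n) x hx)]
    · simp [hx]
  set S := {x | 0 < g x} with hS
  set T := {x | 0 < f x} with hT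
  have hSm : MeasurableSet S := measurableSet_lt measurable_const hg.measurable
  have hTm : MeasurableSet T := measurableSet_lt measurable_const hf.measurable
  have hSQ : S ⊆ Q := fun x (hx : 0 < g x) => by
    by_contra h; exact hx.ne' (hg.eq_zero x h)
  have hTQ : T ⊆ Q := fun x (hx : 0 < f x) => by
    by_contra h; exact hx.ne' (hf.eq_zero x h)
  have hST : volume (S \ T) = 0 := by
    refine volume_pos_sdiff_eq_zero hf hg hQ hQf fun E hEQ hE => ?_
    exact le_of_tendsto_of_tendsto' (hBg.tendsto_volume_inter (fun n => hB _) hQf hE hEQ)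
      (hAf.tendsto_volume_inter hAm hQf hE hEQ) fun n =>
        measureReal_mono (Set.inter_subset_inter_left _ (hBA _))
          ((measure_mono (Set.inter_subset_left.trans (hAQ _))).trans_lt hQf.lt_top).ne
  have hbound := volume_add_le_avoidDensity h₂ hL hρ hK hSm hTm hSQ hTQ hST
    (ae_volume_inter_eq_zero hf hg hQ hQf hpair)
  have hSf : volume S ≠ ⊤ := ((measure_mono hSQ).trans_lt hQf.lt_top).ne
  have hCf : volume (T \ S) ≠ ⊤ :=
    ((measure_mono (Set.sdiff_subset.trans hTQ)).trans_lt hQf.lt_top).ne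
  have hC : ∫ x in T \ S, f x ≤ avoidDensity σ₁.support * volume.real (T \ S) := by
    refine setIntegral_le_of_isCompact_le hf hQ hQf (maxDensity_nonneg _) (hTm.diff hSm) hCf ?_
    intro E hEC hE
    refine setIntegral_le_avoidDensity h₁ hQf hAm (fun n => hB _) (fun n => hBA _)
      (fun n => hs (θ n)) (hs0.comp hθt) (fun n => hB1 _) hAf hBg hE
      (hEC.trans (Set.sdiff_subset.trans hTQ)) ?_
    exact fun x hx => le_antisymm (not_lt.1 (hEC hx).2) (hg.nonneg x)
  have hfi := hf.integrable hQ hQf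
  have hcf : c ≤ ∫ x in Q, f x := by
    refine ge_of_tendsto' (hAf.tendsto_volume_inter hAm hQf hQ subset_rfl) fun n => ?_
    rw [Set.inter_eq_left.2 (hAQ _)]
    exact hc _
  have hsum : ∫ x in Q, f x = (∫ x in S, f x) + ∫ x in T \ S, f x := by
    rw [← setIntegral_union Set.disjoint_sdiff_right (hTm.diff hSm) hfi.integrableOn
      hfi.integrableOn, Set.union_sdiff_self]
    refine setIntegral_eq_of_subset_of_forall_sdiff_eq_zero (f := f) (μ := volume) hQ
      (Set.union_subset hSQ hTQ) ?_
    rintro x ⟨-, hx⟩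
    exact le_antisymm (not_lt.1 fun h => hx (Or.inr h)) (hf.nonneg x)
  have hSle := setIntegral_le_volume hf hQ hQf hSf
  have hC0 : 0 ≤ volume.real (T \ S) := measureReal_nonneg
  have hCW : volume.real (T \ S) ≤ (L + ρ) ^ d := by
    refine (measureReal_mono (Set.sdiff_subset.trans hTQ) hQf).trans ?_
    rw [hQdef, volume_real_cube _ hL.le]
    gcongr
    linarith
  have hW0 : 0 ≤ (L + ρ) ^ d := by positivity
  -- With W = (L+ρ)ᵈ, the inputs are c ≤ |S| + m₁|T \ S| and |S| + m₂|T \ S| ≤ m₂W. If m₁ is the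
  -- larger, add (m₁ - m₂)|T \ S| ≤ (m₁ - m₂)W to the second.
  rcases le_total (avoidDensity σ₁.support) (avoidDensity σ₂.support) with hm | hm
  · rw [max_eq_right hm]
    have := mul_le_mul_of_nonneg_right hm hC0
    linarith
  · rw [max_eq_left hm]
    have := mul_le_mul_of_nonneg_right hm (sub_nonneg.2 hCW)
    linarith

/-- A window of side tL that is at least as full as average, shrunk by t, brings K₂ to unit scale
and K₁ to scale 1/t. Inner regularity then supplies compactness, paid for by the strict gap below
the upper density. -/
theorem exists_isCompact_of_lt_upperDensity {K₁ K₂ A : Set (Euc d)} {t a L : ℝ} (ht : 0 < t)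
    (hL : 0 < L) (ha : 0 ≤ a) (hA : MeasurableSet A) (hav : SetOrAvoiding K₁ (t • K₂) A)
    (h : a < upperDensity A) :
    ∃ B : Set (Euc d), IsCompact B ∧ B ⊆ cube 0 L ∧ SetOrAvoiding (t⁻¹ • K₁) K₂ B ∧
      a * L ^ d ≤ volume.real B := by
  obtain ⟨b, hab, hb⟩ := exists_between h
  obtain ⟨z, hz⟩ := exists_translate_of_lt_upperDensity (mul_pos ht hL) hA
    (measurableSet_cube (0 : Euc d) (t * L)) subset_rfl hb
  set E := cube (0 : Euc d) (t * L) ∩ (fun x => x - z) ⁻¹' A with hE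
  have hEm : MeasurableSet E :=
    (measurableSet_cube _ _).inter ((measurable_sub_const z) hA)
  have hEav : SetOrAvoiding (t⁻¹ • K₁) K₂ (t⁻¹ • E) := by
    have := ((hav.preimage_sub z).mono Set.inter_subset_right : SetOrAvoiding _ _ E).smul
      (inv_ne_zero ht.ne')
    rwa [inv_smul_smul₀ ht.ne'] at this
  have hEQ : t⁻¹ • E ⊆ cube 0 L := by
    have h1 : t⁻¹ • E ⊆ t⁻¹ • cube (0 : Euc d) (t * L) :=
      Set.smul_set_mono Set.inter_subset_left
    rwa [smul_cube (inv_pos.2 ht), inv_mul_cancel_left₀ ht.ne'] at h1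
  have hEm' : MeasurableSet (t⁻¹ • E) := hEm.const_smul₀ t⁻¹
  have hvol : volume.real (t⁻¹ • E) = (t ^ d)⁻¹ * volume.real E := by
    rw [Measure.real, Measure.addHaar_smul, ENNReal.toReal_mul,
      ENNReal.toReal_ofReal (abs_nonneg _)]
    simp [abs_of_pos ht, Measure.real]
  have hlt : a * L ^ d < volume.real (t⁻¹ • E) := by
    rw [volume_real_cube _ (by positivity), mul_pow] at hz
    rw [hvol, lt_inv_mul_iff₀ (by positivity)]
    refine lt_of_lt_of_le ?_ hz
    have : 0 < t ^ d * L ^ d := by positivity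
    nlinarith
  have hlt' : ENNReal.ofReal (a * L ^ d) < volume (t⁻¹ • E) :=
    (ENNReal.ofReal_lt_iff_lt_toReal (by positivity)
      ((measure_mono hEQ).trans_lt (volume_cube_lt_top _ _)).ne).2 hlt
  obtain ⟨B, hBE, hB, hBv⟩ := hEm'.exists_lt_isCompact hlt'
  refine ⟨B, hB, hBE.trans hEQ, hEav.mono hBE, ?_⟩
  exact ((ENNReal.ofReal_lt_iff_lt_toReal (by positivity) hB.measure_lt_top.ne).1 hBv).le

theorem exists_side_length {M a ρ : ℝ} (hM : 0 ≤ M) (hMa : M < a) :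
    ∃ L : ℝ, 0 < L ∧ M * (L + ρ) ^ d < a * L ^ d := by
  have ha : 0 < a := hM.trans_lt hMa
  have h := (tendsto_div_add_pow ρ d).eventually_const_lt ((div_lt_one ha).2 hMa)
  obtain ⟨L, hL, hL0, hLρ⟩ := (h.and ((eventually_gt_atTop 0).and (eventually_gt_atTop (-ρ)))).exists
  have hp : 0 < ρ + L := by linarith
  refine ⟨L, hL0, ?_⟩
  rw [div_pow, div_lt_div_iff₀ ha (by positivity), add_comm ρ L] at hL
  linarith

theorem mainTheorem6 (d : ℕ) (hd : 2 ≤ d) (σ₁ σ₂ : Measure (Euc d))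
    (h₁ : Admissible σ₁) (h₂ : Admissible σ₂) :
    Tendsto (fun t : ℝ => maxDensity (OrAvoiding σ₁ (dilate t σ₂))) atTop
      (𝓝 (max (maxDensity (Avoiding σ₁)) (maxDensity (Avoiding σ₂)))) := by
  set F : ℝ → ℝ := fun t => maxDensity (OrAvoiding σ₁ (dilate t σ₂)) with hF
  have e₁ : maxDensity (Avoiding σ₁) = avoidDensity σ₁.support := by
    rw [avoiding_iff_setAvoiding, avoidDensity]
  have e₂ : maxDensity (Avoiding σ₂) = avoidDensity σ₂.support := by
    rw [avoiding_iff_setAvoiding, avoidDensity]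
  have eF : ∀ t : ℝ, t ≠ 0 → F t = maxDensity (SetOrAvoiding σ₁.support (t • σ₂.support)) := by
    intro t ht
    rw [hF]
    simp only [orAvoiding_iff_setOrAvoiding, support_dilate ht]
  rw [e₁, e₂]
  set M := max (avoidDensity σ₁.support) (avoidDensity σ₂.support) with hM
  have hM0 : 0 ≤ M := (maxDensity_nonneg _).trans (le_max_left _ _)
  have hlower : ∀ t : ℝ, 0 < t → M ≤ F t := by
    intro t ht
    rw [eF t ht.ne']
    refine max_le ?_ ?_
    · exact maxDensity_mono (fun x hx => hx.elim) fun A hA x hx => Or.inl (hA x hx)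
    · rw [← avoidDensity_smul ht]
      exact maxDensity_mono (fun x hx => hx.elim) fun A hA x hx => Or.inr (hA x hx)
  refine tendsto_order.2 ⟨fun a ha => ?_, fun b hb => ?_⟩
  · filter_upwards [eventually_gt_atTop 0] with t ht using ha.trans_le (hlower t ht)
  · by_contra hcon
    have hfreq : ∃ᶠ t in atTop, b ≤ F t ∧ 0 < t := by
      have : ∃ᶠ t in atTop, ¬ F t < b := not_eventually.1 hcon
      exact (this.mono fun t ht => not_lt.1 ht).and_eventually (eventually_gt_atTop 0)
    obtain ⟨t, ht, htF⟩ := exists_seq_forall_of_frequently hfreq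
    obtain ⟨a, hMa, hab⟩ := exists_between hb
    obtain ⟨ρ, hρ, hK⟩ := exists_box_of_isCompact h₂.compact_support
    -- L is fixed after ρ and before the sequence of sets, large enough that the boundary loss
    -- (L+ρ)ᵈ/Lᵈ does not close the gap between `M` and `a`.
    obtain ⟨L, hL, hLa⟩ := exists_side_length (d := d) (ρ := ρ) hM0 hMa
    have hex : ∀ n, ∃ B : Set (Euc d), IsCompact B ∧ B ⊆ cube 0 L ∧
        SetOrAvoiding ((t n)⁻¹ • σ₁.support) σ₂.support B ∧ a * L ^ d ≤ volume.real B := by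
      intro n
      obtain ⟨hbF, ht0⟩ := htF n
      have haF := hab.trans_le hbF
      rw [eF _ ht0.ne'] at haF
      obtain ⟨A, hA, hAav, hAa⟩ := exists_measurable_lt_upperDensity
        (fun x hx => hx.elim) (fun _ _ => SetOrAvoiding.mono) haF
      exact exists_isCompact_of_lt_upperDensity ht0 hL (hM0.trans hMa.le) hA hAav hAa
    choose B hB hBQ hBav hBv using hex
    have := volume_le_of_setOrAvoiding_seq h₁.compact_support h₂ hL hρ hK hB hBQ
      (fun n => inv_pos.2 (htF n).2) (tendsto_inv_atTop_zero.comp ht) hBav hBv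
    exact absurd hLa (not_lt.2 this)
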